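/- Let $n\ge 2$, $N=n^2$, and let the $N$ vertices $|x,y\rangle$, $x,y\in\mathbb Z/n\mathbb Z$, form the $\sqrt N\times\sqrt N$ grid with periodic boundary conditions. Let $|\Uparrow\rangle=|0\rangle$, $|\Downarrow\rangle=|1\rangle$ be the standard basis of the coin space $\mathbb C^2$, let $|\Leftarrow\rangle=\frac1{\sqrt2}(|0\rangle+|1\rangle)$, $|\Rightarrow\rangle=\frac1{\sqrt2}(|0\rangle-|1\rangle)$ be its Hadamard basis, and $|s\rangle=\frac1{\sqrt2}(|\Uparrow\rangle+|\Downarrow\rangle)$. Let $U$ be the unitary on $\mathbb C^2\otimes\mathbb C^N$ that first moves up/down, $|\Uparrow\rangle|x,y\rangle\mapsto|\Uparrow\rangle|x,y-1\rangle$, $|\Downarrow\rangle|x,y\rangle\mapsto|\Downarrow\rangle|x,y+1\rangle$, and then moves left/right, $|\Leftarrow\rangle|x,y\rangle\mapsto|\Leftarrow\rangle|x-1,y\rangle$, $|\Rightarrow\rangle|x,y\rangle\mapsto|\Rightarrow\rangle|x+1,y\rangle$. For a marked vertex $v$ let $U'_v=U(I-2|s,v\rangle\langle s,v|)$. (a)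 There are absolute constants $C,c>0$ such that for every $n\ge2$ there is a $T\le C\sqrt{N\log N}$ such that for every marked vertex $v$, applying $U'_v$ to the uniform superposition $\frac1{\sqrt{2N}}\sum_{i,x,y}|i\rangle|x,y\rangle$ $T$ times and then measuring the vertex register gives $v$ with probability at least $c/\log N$. (b) A local search algorithm with internal space $\mathbb C^2$ is a finite sequence of steps, applied in order to a fixed starting state in $\mathbb C^2\otimes\mathbb C^N$. Each step is either a query, given by two unitaries $Q_0,Q_1$ of $\mathbb C^2$, where $Q_1$ is applied to the internal register at the marked vertex and $Q_0$ at the other vertices; or a local transformation, a unitary that does not depend on the marked vertex and maps every state located at a vertex to a state supported on this vertex and its neighbours in the grid. There are absolute constants $C,c>0$ such that for every $n\ge2$ there is a local search algorithm with starting state $|\Uparrow\rangle|0,0\rangle$ and at most $C\sqrt N\log N$ steps such that, for every marked vertex $v$, measuring the vertex register of its final state gives $v$ with probability at least $c$. -/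

import Mathlib

open scoped Matrix Kronecker

namespace GridSearch

/-- The vertices of the `n × n` grid with periodic boundary conditions, as pairs `(x, y)`. -/
abbrev Grid (n : ℕ) : Type := ZMod n × ZMod n

/-- The grid as an undirected graph: two distinct vertices are adjacent when they differ by
one step in the horizontal or in the vertical direction. -/
def gridGraph (n : ℕ) : SimpleGraph (Grid n) :=
  SimpleGraph.circulantGraph {((1 : ZMod n), (0 : ZMod n)), ((0 : ZMod n), (1 : ZMod n))}

/-! ### Measurement -/

/-- The probability that measuring the vertex register of the state `ψ` gives `v`. -/
noncomputable def probAt {ι V : Type*} [Fintype ι] (ψ : ι × V → ℂ) (v : V) : ℝ :=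
  ∑ i, ‖ψ (i, v)‖ ^ 2

/-! ### The quantum walk with a two-dimensional coin -/

/-- The coin state `⇑`. -/
def ketUp : Fin 2 → ℂ := ![1, 0]

/-- The coin state `⇓`. -/
def ketDown : Fin 2 → ℂ := ![0, 1]

/-- The coin state `⇐ = (⇑ + ⇓) / √2`. -/
noncomputable def ketLeft : Fin 2 → ℂ := ((√2 : ℝ) : ℂ)⁻¹ • (ketUp + ketDown)

/-- The coin state `⇒ = (⇑ - ⇓) / √2`. -/
noncomputable def ketRight : Fin 2 → ℂ := ((√2 : ℝ) : ℂ)⁻¹ • (ketUp - ketDown)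

/-- The uniform coin state `s = (⇑ + ⇓) / √2`. -/
noncomputable def ketS : Fin 2 → ℂ := ((√2 : ℝ) : ℂ)⁻¹ • (ketUp + ketDown)

/-- The rank one operator `|a⟩⟨a|`. -/
noncomputable def ketbra {m : Type*} (a : m → ℂ) : Matrix m m ℂ := Matrix.vecMulVec a (star a)

/-- The translation `|v⟩ ↦ |v + g⟩` of the vertex register. -/
def shift (n : ℕ) (g : Grid n) : Matrix (Grid n) (Grid n) ℂ :=
  Matrix.of fun w v => if w = v + g then 1 else 0

/-- Move up/down: `|⇑⟩|x, y⟩ ↦ |⇑⟩|x, y - 1⟩` and `|⇓⟩|x, y⟩ ↦ |⇓⟩|x, y + 1⟩`. -/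
noncomputable def moveUpDown (n : ℕ) : Matrix (Fin 2 × Grid n) (Fin 2 × Grid n) ℂ :=
  ketbra ketUp ⊗ₖ shift n (0, -1) + ketbra ketDown ⊗ₖ shift n (0, 1)

/-- Move left/right: `|⇐⟩|x, y⟩ ↦ |⇐⟩|x - 1, y⟩` and `|⇒⟩|x, y⟩ ↦ |⇒⟩|x + 1, y⟩`. -/
noncomputable def moveLeftRight (n : ℕ) : Matrix (Fin 2 × Grid n) (Fin 2 × Grid n) ℂ :=
  ketbra ketLeft ⊗ₖ shift n (-1, 0) + ketbra ketRight ⊗ₖ shift n (1, 0)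

/-- One step `U` of the walk without marked vertex: first up/down, then left/right. -/
noncomputable def walk (n : ℕ) [NeZero n] : Matrix (Fin 2 × Grid n) (Fin 2 × Grid n) ℂ :=
  moveLeftRight n * moveUpDown n

/-- The state `|s, v⟩`. -/
noncomputable def ketSV (n : ℕ) (v : Grid n) : Fin 2 × Grid n → ℂ :=
  fun p => if p.2 = v then ketS p.1 else 0

/-- One step `U' = U (I - 2 |s, v⟩⟨s, v|)` of the walk with marked vertex `v`. -/
noncomputable def markedWalk (n : ℕ) [NeZero n] (v : Grid n) :
    Matrix (Fin 2 × Grid n) (Fin 2 × Grid n) ℂ :=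
  walk n * (1 - (2 : ℂ) • ketbra (ketSV n v))

/-- The uniform superposition over all coin states and all vertices. -/
noncomputable def uniformState (n : ℕ) [NeZero n] : Fin 2 × Grid n → ℂ :=
  fun _ => ((√(Fintype.card (Fin 2 × Grid n) : ℝ) : ℝ) : ℂ)⁻¹

/-- The success probability of the quantum walk search algorithm: start in the uniform
superposition, apply the marked walk `T` times, measure the vertex register. -/
noncomputable def walkSuccess (n : ℕ) [NeZero n] (v : Grid n) (T : ℕ) : ℝ :=
  probAt ((markedWalk n v ^ T) *ᵥ uniformState n) v

/-! ### Local quantum search algorithms on a graph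

The state space is spanned by `|i⟩|v⟩` with `i : ι` an internal basis state and `v : V` a
vertex; the input is a bit `a v` for every vertex `v`. -/

/-- A transformation is `Z`-local on `G` if it maps every state located at a vertex `v` to a
state supported on `v` and the neighbours of `v`. -/
def IsZLocal {ι V : Type*} (G : SimpleGraph V) (U : Matrix (ι × V) (ι × V) ℂ) : Prop :=
  ∀ i j v w, U (j, w) (i, v) ≠ 0 → w = v ∨ G.Adj v w

/-- One step of a local algorithm: a query, which applies the first unitary to the internal
register at the vertices with `a v = 0` and the second one at those with `a v = 1`, or a
`Z`-local unitary, which does not depend on the input. -/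
inductive Step (ι : Type) {V : Type} [Fintype ι] [DecidableEq ι] [Fintype V] [DecidableEq V]
    (G : SimpleGraph V) : Type
  | query (U₀ U₁ : Matrix.unitaryGroup ι ℂ) : Step ι G
  | localStep (U : Matrix.unitaryGroup (ι × V) ℂ) (hU : IsZLocal G U.1) : Step ι G

section Algorithm

variable {ι V : Type} [Fintype ι] [DecidableEq ι] [Fintype V] [DecidableEq V]
  {G : SimpleGraph V}

/-- The operator that a step applies on input `a`. -/
def Step.op (a : V → Bool) : Step ι G → Matrix (ι × V) (ι × V) ℂ
  | .query U₀ U₁ => Matrix.of fun p q =>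
      if p.2 = q.2 then (if a q.2 then U₁.1 p.1 q.1 else U₀.1 p.1 q.1) else 0
  | .localStep U _ => U.1

/-- The final state `U_t ⋯ U_1 ψ` of the algorithm with steps `U_1, …, U_t` (in the order
of the list) and starting state `ψ`, on input `a`. -/
def finalState (steps : List (Step ι G)) (ψ : ι × V → ℂ) (a : V → Bool) : ι × V → ℂ :=
  steps.foldl (fun φ s => s.op a *ᵥ φ) ψ

/-- The probability that measuring the vertex register of the final state gives a vertex `v`
with `a v = 1`. -/
noncomputable def algorithmSuccess (steps : List (Step ι G)) (ψ : ι × V → ℂ)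
    (a : V → Bool) : ℝ :=
  ∑ v, if a v then probAt (finalState steps ψ a) v else 0

end Algorithm

/-- The state `|⇑⟩|0, 0⟩`, located at a single vertex. -/
noncomputable def originState (n : ℕ) : Fin 2 × Grid n → ℂ :=
  fun p => if p.2 = (0, 0) then ketUp p.1 else 0

end GridSearch

/-! Write φ for the marked state |s,v⟩, u for the uniform state, W = U(1 - 2|φ⟩⟨φ|) and L = log N.
For 0 < z < 1, test the walk against η = (1 - z U†)⁻¹φ. Then z⟨η|Wx⟩ = ⟨η|x⟩ - D⟨φ|x⟩ with D =
2⟨η|φ⟩ - 1, and multiplying by zᵗ and telescoping gives D Σ_{t<T} zᵗ⟨φ|Wᵗu⟩ = ⟨η|u⟩ - z^T⟨η|W^T u⟩.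
Since Uu = u, the first term on the right is ⟨φ|u⟩/(1-z). Unitarity gives Re D = (1-z²)‖η‖², and D
is real because every vector involved is. So a bound on ‖η‖² prevents all amplitudes ⟨φ|Wᵗu⟩ with t
< T from being small (`exists_large_amplitude`); no spectral analysis of W is needed.

To bound ‖η‖², put η = (1 - zU)G with (1 - zU†)(1 - zU)G = φ. This product is 1 + z² - z(U + U†),
and U + U† acts as a scalar diagonal random walk, identically on both coin states
(`walk_add_conjTranspose_mulVec`). Hence G is the scalar Green function times s, and ‖η‖² = ⟨G|φ⟩ is
its value at the origin, a lattice sum (`sqNorm_resolventState`). With 1 - z = 1/√(NL) that sum is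
O(L) (`green_zero_le`), the logarithm being the two-dimensional one. Then ⟨η|u⟩ = √L and |D| =
O(L/√(NL)), so some t = O(√(NL)) has an amplitude of order 1/√L at least. Translation invariance
(`walkSuccess_eq`) makes this t valid for every marked vertex.

For constant probability, the uniform state is prepared from the origin in O(√N) local steps and the
whole procedure is amplified. The reflection about the starting state is local because that state
sits at one vertex, so a round costs O(√(NL)) steps. Since the success probability p is the same for
all marked vertices, one number of rounds, at most 1/√p = O(√L), works for all of them
(`exists_amplify`). -/

namespace GridSearch

/-! ### Vectors, norms and unitary matrices -/

section Vectors

variable {m : Type*} [Fintype m]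

/-- The squared Euclidean norm of a complex vector. -/
noncomputable def sqNorm (x : m → ℂ) : ℝ := ∑ i, ‖x i‖ ^ 2

lemma sqNorm_nonneg (x : m → ℂ) : 0 ≤ sqNorm x :=
  Finset.sum_nonneg fun _ _ => by positivity

lemma star_dotProduct_self (x : m → ℂ) : star x ⬝ᵥ x = (sqNorm x : ℂ) := by
  simp only [dotProduct, sqNorm, Pi.star_apply, Complex.ofReal_sum]
  refine Finset.sum_congr rfl fun i _ => ?_
  rw [Complex.star_def, Complex.conj_mul', Complex.ofReal_pow]

lemma norm_dotProduct_sq_le (x y : m → ℂ) :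
    ‖star x ⬝ᵥ y‖ ^ 2 ≤ sqNorm x * sqNorm y := by
  have h : ‖star x ⬝ᵥ y‖ ≤ ∑ i, ‖x i‖ * ‖y i‖ := by
    refine (norm_sum_le _ _).trans (le_of_eq (Finset.sum_congr rfl fun i _ => ?_))
    simp
  calc ‖star x ⬝ᵥ y‖ ^ 2 ≤ (∑ i, ‖x i‖ * ‖y i‖) ^ 2 := by gcongr
    _ ≤ _ := Finset.sum_mul_sq_le_sq_mul_sq _ _ _

lemma star_dotProduct_mulVec (A : Matrix m m ℂ) (x y : m → ℂ) :
    star x ⬝ᵥ (A *ᵥ y) = star (Aᴴ *ᵥ x) ⬝ᵥ y := by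
  rw [Matrix.star_mulVec, Matrix.conjTranspose_conjTranspose, Matrix.dotProduct_mulVec]

lemma star_dotProduct_comm (x y : m → ℂ) : star x ⬝ᵥ y = star (star y ⬝ᵥ x) :=
  Matrix.star_dotProduct x y

lemma ketbra_mulVec (a x : m → ℂ) : ketbra a *ᵥ x = (star a ⬝ᵥ x) • a := by
  rw [ketbra, Matrix.vecMulVec_mulVec]
  ext i
  simp [mul_comm]

lemma conjTranspose_ketbra {m : Type*} (a : m → ℂ) : (ketbra a)ᴴ = ketbra a := by
  ext i j
  simp [ketbra, Matrix.vecMulVec_apply, mul_comm]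

lemma ketbra_mul_ketbra (a b : m → ℂ) :
    ketbra a * ketbra b = (star a ⬝ᵥ b) • Matrix.vecMulVec a (star b) := by
  rw [ketbra, ketbra, Matrix.vecMulVec_mul_vecMulVec]
  ext i j
  simp [Matrix.vecMulVec_apply]
  ring

/-- Pair the resolvent equation with x and move Uᴴ to the other side. -/
lemma resolvent_dual_dotProduct {U : Matrix m m ℂ} {φ η : m → ℂ} {z : ℝ}
    (hη : η - (z : ℂ) • (Uᴴ *ᵥ η) = φ)
    (x : m → ℂ) :
    (z : ℂ) * (star η ⬝ᵥ (U *ᵥ x)) = star η ⬝ᵥ x - star φ ⬝ᵥ x := by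
  rw [← hη, star_dotProduct_mulVec, star_sub, star_smul, sub_dotProduct, smul_dotProduct]
  simp

variable [DecidableEq m]

lemma sqNorm_mulVec {A : Matrix m m ℂ} (hA : A ∈ Matrix.unitaryGroup m ℂ) (x : m → ℂ) :
    sqNorm (A *ᵥ x) = sqNorm x := by
  have h : star (A *ᵥ x) ⬝ᵥ (A *ᵥ x) = star x ⬝ᵥ x := by
    rw [star_dotProduct_mulVec, Matrix.mulVec_mulVec, ← Matrix.star_eq_conjTranspose,
      Matrix.mem_unitaryGroup_iff'.1 hA, Matrix.one_mulVec]
  rw [star_dotProduct_self, star_dotProduct_self] at h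
  exact_mod_cast h

/-- The reflection `1 - r |w⟩⟨w|` is unitary if `r = 0` or `r * ‖w‖ ^ 2 = 2`. -/
lemma reflection_mem_unitaryGroup (w : m → ℂ) (r : ℝ) (hr : r * (r * sqNorm w) = 2 * r) :
    1 - (r : ℂ) • ketbra w ∈ Matrix.unitaryGroup m ℂ := by
  rw [Matrix.mem_unitaryGroup_iff]
  have h : star (1 - (r : ℂ) • ketbra w) = 1 - (r : ℂ) • ketbra w := by
    rw [Matrix.star_eq_conjTranspose, Matrix.conjTranspose_sub, Matrix.conjTranspose_smul,
      conjTranspose_ketbra]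
    simp
  have h2 : ketbra w * ketbra w = (sqNorm w : ℂ) • ketbra w := by
    rw [ketbra_mul_ketbra, star_dotProduct_self]; rfl
  have h3 : (r : ℂ) * r * sqNorm w = 2 * r := by
    rw [mul_assoc]; exact_mod_cast hr
  rw [h, sub_mul, mul_sub, mul_sub, one_mul, mul_one, one_mul, Matrix.smul_mul, Matrix.mul_smul,
    h2, smul_smul, smul_smul, h3, two_mul, add_smul]
  abel

/-! ### Searching with a marked reflection

The dual vector `η = (1 - z Uᴴ)⁻¹ φ` turns the walk with reflection into a scalar recurrence
for the amplitudes at `φ`. -/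

section Search

variable {U : Matrix m m ℂ} {u φ η : m → ℂ} {z : ℝ}

/-- The reflection subtracts 2⟨φ|x⟩φ from x before U acts, so beyond the free recurrence only
multiples of ⟨φ|x⟩ appear. -/
lemma resolvent_dual_step (hφ : sqNorm φ = 1)
    (hη : η - (z : ℂ) • (Uᴴ *ᵥ η) = φ) (x : m → ℂ) :
    (z : ℂ) * (star η ⬝ᵥ ((U * (1 - (2 : ℂ) • ketbra φ)) *ᵥ x)) =
      star η ⬝ᵥ x - (2 * (star η ⬝ᵥ φ) - 1) * (star φ ⬝ᵥ x) := by
  rw [← Matrix.mulVec_mulVec, Matrix.sub_mulVec, Matrix.one_mulVec, Matrix.smul_mulVec,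
    ketbra_mulVec, resolvent_dual_dotProduct hη, dotProduct_sub, dotProduct_sub,
    dotProduct_smul, dotProduct_smul, dotProduct_smul, dotProduct_smul, star_dotProduct_self, hφ]
  simp only [smul_eq_mul, Complex.ofReal_one]
  ring

/-- Expand 1 = ‖η - zUᴴη‖² using ‖Uᴴη‖ = ‖η‖, and eliminate the cross term with ⟨η|φ⟩ = ‖η‖² -
z⟨η|Uᴴη⟩. The factor 1 - z² is what makes the coefficient of the recurrence small. -/
lemma resolvent_dual_re (hU : U ∈ Matrix.unitaryGroup m ℂ) (hφ : sqNorm φ = 1)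
    (hη : η - (z : ℂ) • (Uᴴ *ᵥ η) = φ) :
    2 * (star η ⬝ᵥ φ).re - 1 = (1 - z ^ 2) * sqNorm η := by
  have hU' : Uᴴ ∈ Matrix.unitaryGroup m ℂ := by
    rw [← Matrix.star_eq_conjTranspose]; exact Unitary.star_mem hU
  have e1 : star η ⬝ᵥ φ = (sqNorm η : ℂ) - z * (star η ⬝ᵥ (Uᴴ *ᵥ η)) := by
    rw [← hη, dotProduct_sub, dotProduct_smul, star_dotProduct_self, smul_eq_mul]
  have e2 : (sqNorm φ : ℂ) = sqNorm η - z * (star η ⬝ᵥ (Uᴴ *ᵥ η))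
      - z * star (star η ⬝ᵥ (Uᴴ *ᵥ η)) + z ^ 2 * sqNorm η := by
    rw [← star_dotProduct_self, ← star_dotProduct_comm, ← hη, star_sub, star_smul,
      sub_dotProduct, dotProduct_sub, dotProduct_sub, smul_dotProduct, smul_dotProduct,
      dotProduct_smul, dotProduct_smul, star_dotProduct_self, star_dotProduct_self,
      sqNorm_mulVec hU']
    simp only [smul_eq_mul, Complex.star_def, Complex.conj_ofReal]
    ring
  have e1' := congrArg Complex.re e1
  have e2' := congrArg Complex.re e2
  rw [hφ] at e2'
  simp [pow_two] at e1' e2'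
  rw [e1']
  linarith

/-- A bound on the resolvent of `U` at the marked vector `φ` forces the walk with marked
reflection to have a large amplitude at `φ` at some time before `T`. -/
theorem exists_large_amplitude (hU : U ∈ Matrix.unitaryGroup m ℂ) (hu : U *ᵥ u = u)
    (hu1 : sqNorm u = 1) (hφ : sqNorm φ = 1) (hz0 : 0 < z) (hz1 : z < 1)
    (hη : η - (z : ℂ) • (Uᴴ *ᵥ η) = φ) (him : (star η ⬝ᵥ φ).im = 0) {B : ℝ}
    (hB : sqNorm η ≤ B) (T : ℕ) {ε : ℝ}
    (hε : ∀ t < T, ‖star φ ⬝ᵥ (((U * (1 - (2 : ℂ) • ketbra φ)) ^ t) *ᵥ u)‖ ≤ ε) :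
    ‖star φ ⬝ᵥ u‖ / (1 - z) - z ^ T * √B ≤ (1 - z ^ 2) * B * (T * ε) := by
  set W := U * (1 - (2 : ℂ) • ketbra φ) with hW
  set D : ℂ := 2 * (star η ⬝ᵥ φ) - 1 with hD
  have hWu : W ∈ Matrix.unitaryGroup m ℂ := by
    refine mul_mem hU ?_
    have := reflection_mem_unitaryGroup φ 2 (by rw [hφ]; norm_num)
    simpa using this
  have hDr : D = ((1 - z ^ 2) * sqNorm η : ℝ) := by
    apply Complex.ext
    · rw [Complex.ofReal_re, ← resolvent_dual_re hU hφ hη, hD]; simp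
    · rw [Complex.ofReal_im, hD]; simp [him]
  have hz2 : 0 ≤ 1 - z ^ 2 := by nlinarith
  have hDn : ‖D‖ ≤ (1 - z ^ 2) * B := by
    rw [hDr, Complex.norm_real, Real.norm_of_nonneg (mul_nonneg hz2 (sqNorm_nonneg _))]
    gcongr
  -- The recurrence, weighted by zᵗ, telescopes.
  have hsum : ∀ T : ℕ, D * ∑ t ∈ Finset.range T, (z : ℂ) ^ t * (star φ ⬝ᵥ ((W ^ t) *ᵥ u)) =
      star η ⬝ᵥ u - z ^ T * (star η ⬝ᵥ ((W ^ T) *ᵥ u)) := by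
    intro T
    induction T with
    | zero => simp
    | succ T ih =>
      have h := resolvent_dual_step (U := U) hφ hη ((W ^ T) *ᵥ u)
      rw [← hW, ← hD, Matrix.mulVec_mulVec, ← pow_succ'] at h
      rw [Finset.sum_range_succ, mul_add, ih, pow_succ (z : ℂ), mul_assoc _ (z : ℂ), h]
      ring
  have hnorm : ∀ t, sqNorm ((W ^ t) *ᵥ u) = 1 := fun t => by
    rw [sqNorm_mulVec (pow_mem hWu t), hu1]
  -- Invariance of u amplifies its overlap with φ by the factor 1/(1-z).
  have he0 : ((1 - z : ℝ) : ℂ) * (star η ⬝ᵥ u) = star φ ⬝ᵥ u := by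
    have h := resolvent_dual_dotProduct hη u
    rw [hu] at h
    push_cast
    linear_combination -h
  have he0' : ‖star η ⬝ᵥ u‖ = ‖star φ ⬝ᵥ u‖ / (1 - z) := by
    rw [← he0, norm_mul, Complex.norm_real, Real.norm_of_nonneg (by linarith)]
    field_simp [(by linarith : (1 - z) ≠ 0)]
  have heT : ‖star η ⬝ᵥ ((W ^ T) *ᵥ u)‖ ≤ √B := by
    apply Real.le_sqrt_of_sq_le
    have := norm_dotProduct_sq_le η ((W ^ T) *ᵥ u)
    rw [hnorm, mul_one] at this
    exact this.trans hB
  have hB0 : 0 ≤ B := (sqNorm_nonneg η).trans hB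
  calc ‖star φ ⬝ᵥ u‖ / (1 - z) - z ^ T * √B
      ≤ ‖star η ⬝ᵥ u‖ - ‖(z : ℂ) ^ T * (star η ⬝ᵥ ((W ^ T) *ᵥ u))‖ := by
        rw [he0', norm_mul, norm_pow, Complex.norm_real, Real.norm_of_nonneg hz0.le]
        gcongr
    _ ≤ ‖star η ⬝ᵥ u - z ^ T * (star η ⬝ᵥ ((W ^ T) *ᵥ u))‖ := norm_sub_norm_le _ _
    _ = ‖D‖ * ‖∑ t ∈ Finset.range T, (z : ℂ) ^ t * (star φ ⬝ᵥ ((W ^ t) *ᵥ u))‖ := by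
        rw [← hsum, norm_mul]
    _ ≤ (1 - z ^ 2) * B * (T * ε) := by
        refine mul_le_mul hDn ?_ (norm_nonneg _) (mul_nonneg hz2 hB0)
        refine (norm_sum_le_of_le _ (f := fun t => (z : ℂ) ^ t * (star φ ⬝ᵥ ((W ^ t) *ᵥ u)))
          (n := fun _ => ε) fun t ht => ?_).trans (by simp)
        have h1 := hε t (Finset.mem_range.1 ht)
        rw [norm_mul, norm_pow, Complex.norm_real, Real.norm_of_nonneg hz0.le]
        calc z ^ t * _ ≤ 1 * ‖star φ ⬝ᵥ ((W ^ t) *ᵥ u)‖ := by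
              gcongr
              exact pow_le_one₀ hz0.le hz1.le
          _ ≤ ε := by rw [one_mul]; exact h1

end Search

end Vectors

/-! ### The action of the walk on vectors -/

section Walk

lemma conjTranspose_shift {n : ℕ} (g : Grid n) : (shift n g)ᴴ = shift n (-g) := by
  ext v w
  simp only [shift, Matrix.conjTranspose_apply, Matrix.of_apply]
  by_cases h : w = v + g
  · simp [h]
  · have : ¬ v = w + -g := fun h' => h (by rw [h']; abel)
    simp [h, this]

lemma shift_zero {n : ℕ} : shift n 0 = 1 := by
  ext v w
  simp [shift, Matrix.one_apply]

variable {n : ℕ} [NeZero n]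

lemma shift_mul_shift (g h : Grid n) : shift n g * shift n h = shift n (g + h) := by
  ext v w
  simp only [shift, Matrix.mul_apply, Matrix.of_apply]
  rw [Finset.sum_eq_single (w + h)]
  · simp [add_comm, add_left_comm]
  · intro b _ hb
    simp [hb]
  · simp

/-- The conditional move that translates by `g` on the coin state `a` and by `h` on the coin
state `b`. -/
noncomputable def condMove (n : ℕ) (a b : Fin 2 → ℂ) (g h : Grid n) :
    Matrix (Fin 2 × Grid n) (Fin 2 × Grid n) ℂ :=
  ketbra a ⊗ₖ shift n g + ketbra b ⊗ₖ shift n h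

lemma moveUpDown_eq (n : ℕ) : moveUpDown n = condMove n ketUp ketDown (0, -1) (0, 1) := rfl

lemma moveLeftRight_eq (n : ℕ) :
    moveLeftRight n = condMove n ketLeft ketRight (-1, 0) (1, 0) := rfl

lemma conjTranspose_condMove {n : ℕ} (a b : Fin 2 → ℂ) (g h : Grid n) :
    (condMove n a b g h)ᴴ = condMove n a b (-g) (-h) := by
  simp only [condMove, Matrix.conjTranspose_add, Matrix.conjTranspose_kronecker,
    conjTranspose_ketbra, conjTranspose_shift]

lemma kronecker_shift_mulVec (K : Matrix (Fin 2) (Fin 2) ℂ) (g : Grid n)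
    (ψ : Fin 2 × Grid n → ℂ) (i : Fin 2) (w : Grid n) :
    ((K ⊗ₖ shift n g) *ᵥ ψ) (i, w) = ∑ j, K i j * ψ (j, w - g) := by
  rw [Matrix.mulVec, dotProduct, Fintype.sum_prod_type]
  refine Finset.sum_congr rfl fun j _ => ?_
  rw [Finset.sum_eq_single (w - g)]
  · simp [shift]
  · intro b _ hb
    have : ¬ w = b + g := fun h => hb (by rw [h]; abel)
    simp [shift, this]
  · simp

/-- Orthogonality kills the cross terms, and on each remaining term the shift cancels against its
inverse, leaving the resolution of the identity on the coin. -/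
lemma condMove_mem_unitaryGroup {a b : Fin 2 → ℂ} (hab : star a ⬝ᵥ b = 0)
    (h1 : ketbra a * ketbra a + ketbra b * ketbra b = 1) (g h : Grid n) :
    condMove n a b g h ∈ Matrix.unitaryGroup (Fin 2 × Grid n) ℂ := by
  have hba : star b ⬝ᵥ a = 0 := by rw [star_dotProduct_comm, hab, star_zero]
  have e1 : ketbra a * ketbra b = 0 := by rw [ketbra_mul_ketbra, hab, zero_smul]
  have e2 : ketbra b * ketbra a = 0 := by rw [ketbra_mul_ketbra, hba, zero_smul]
  rw [Matrix.mem_unitaryGroup_iff, Matrix.star_eq_conjTranspose, conjTranspose_condMove, condMove,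
    condMove, add_mul, mul_add, mul_add, ← Matrix.mul_kronecker_mul, ← Matrix.mul_kronecker_mul,
    ← Matrix.mul_kronecker_mul, ← Matrix.mul_kronecker_mul, e1, e2, shift_mul_shift,
    shift_mul_shift, shift_mul_shift, shift_mul_shift, add_neg_cancel, add_neg_cancel, shift_zero, Matrix.zero_kronecker,
    Matrix.zero_kronecker, add_zero, zero_add, ← Matrix.add_kronecker, h1,
    Matrix.one_kronecker_one]

lemma inv_sqrt_two_mul_self : ((√2 : ℝ) : ℂ)⁻¹ * ((√2 : ℝ) : ℂ)⁻¹ = 1 / 2 := by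
  rw [← mul_inv, ← Complex.ofReal_mul, Real.mul_self_sqrt (by norm_num)]
  norm_num

lemma ketbra_ketUp : ketbra ketUp = !![1, 0; 0, 0] := by
  ext i j
  fin_cases i <;> fin_cases j <;> simp [ketbra, ketUp, Matrix.vecMulVec_apply]

lemma ketbra_ketDown : ketbra ketDown = !![0, 0; 0, 1] := by
  ext i j
  fin_cases i <;> fin_cases j <;> simp [ketbra, ketDown, Matrix.vecMulVec_apply]

lemma ketbra_ketLeft : ketbra ketLeft = !![1 / 2, 1 / 2; 1 / 2, 1 / 2] := by
  ext i j
  fin_cases i <;> fin_cases j <;>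
    simpa [ketbra, ketLeft, ketUp, ketDown, Matrix.vecMulVec_apply] using inv_sqrt_two_mul_self

lemma ketbra_ketRight : ketbra ketRight = !![1 / 2, -1 / 2; -1 / 2, 1 / 2] := by
  have h := inv_sqrt_two_mul_self
  ext i j
  fin_cases i <;> fin_cases j <;>
    simp [ketbra, ketRight, ketUp, ketDown, Matrix.vecMulVec_apply] <;> simp [h] <;>
    norm_num at h ⊢

lemma moveUpDown_mem_unitaryGroup :
    moveUpDown n ∈ Matrix.unitaryGroup (Fin 2 × Grid n) ℂ := by
  rw [moveUpDown_eq]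
  apply condMove_mem_unitaryGroup
  · simp [ketUp, ketDown, dotProduct]
  · rw [ketbra_ketUp, ketbra_ketDown]
    ext i j
    fin_cases i <;> fin_cases j <;> simp

lemma moveLeftRight_mem_unitaryGroup :
    moveLeftRight n ∈ Matrix.unitaryGroup (Fin 2 × Grid n) ℂ := by
  rw [moveLeftRight_eq]
  apply condMove_mem_unitaryGroup
  · simp [ketLeft, ketRight, ketUp, ketDown, dotProduct]
  · rw [ketbra_ketLeft, ketbra_ketRight]
    ext i j
    fin_cases i <;> fin_cases j <;> simp <;> norm_num

lemma walk_mem_unitaryGroup : walk n ∈ Matrix.unitaryGroup (Fin 2 × Grid n) ℂ :=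
  mul_mem moveLeftRight_mem_unitaryGroup moveUpDown_mem_unitaryGroup

lemma condMove_mulVec (a b : Fin 2 → ℂ) (g h : Grid n) (ψ : Fin 2 × Grid n → ℂ) (i : Fin 2)
    (w : Grid n) :
    (condMove n a b g h *ᵥ ψ) (i, w) =
      (ketbra a i 0 * ψ (0, w - g) + ketbra a i 1 * ψ (1, w - g)) +
        (ketbra b i 0 * ψ (0, w - h) + ketbra b i 1 * ψ (1, w - h)) := by
  rw [condMove, Matrix.add_mulVec, Pi.add_apply, kronecker_shift_mulVec, kronecker_shift_mulVec,
    Fin.sum_univ_two, Fin.sum_univ_two]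

lemma walk_mulVec_zero (ψ : Fin 2 × Grid n → ℂ) (x y : ZMod n) :
    (walk n *ᵥ ψ) (0, (x, y)) =
      (ψ (0, (x + 1, y + 1)) + ψ (1, (x + 1, y - 1))
        + ψ (0, (x - 1, y + 1)) - ψ (1, (x - 1, y - 1))) / 2 := by
  rw [walk, ← Matrix.mulVec_mulVec, moveLeftRight_eq, moveUpDown_eq]
  simp only [condMove_mulVec, ketbra_ketUp, ketbra_ketDown, ketbra_ketLeft, ketbra_ketRight]
  simp
  ring

lemma walk_mulVec_one (ψ : Fin 2 × Grid n → ℂ) (x y : ZMod n) :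
    (walk n *ᵥ ψ) (1, (x, y)) =
      (ψ (0, (x + 1, y + 1)) + ψ (1, (x + 1, y - 1))
        - ψ (0, (x - 1, y + 1)) + ψ (1, (x - 1, y - 1))) / 2 := by
  rw [walk, ← Matrix.mulVec_mulVec, moveLeftRight_eq, moveUpDown_eq]
  simp only [condMove_mulVec, ketbra_ketUp, ketbra_ketDown, ketbra_ketLeft, ketbra_ketRight]
  simp
  ring

lemma conjTranspose_walk_mulVec_zero (ψ : Fin 2 × Grid n → ℂ) (x y : ZMod n) :
    ((walk n)ᴴ *ᵥ ψ) (0, (x, y)) =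
      (ψ (0, (x - 1, y - 1)) + ψ (1, (x - 1, y - 1))
        + ψ (0, (x + 1, y - 1)) - ψ (1, (x + 1, y - 1))) / 2 := by
  rw [walk, Matrix.conjTranspose_mul, ← Matrix.mulVec_mulVec, moveLeftRight_eq, moveUpDown_eq,
    conjTranspose_condMove, conjTranspose_condMove]
  simp only [condMove_mulVec, ketbra_ketUp, ketbra_ketDown, ketbra_ketLeft, ketbra_ketRight]
  simp
  ring

lemma conjTranspose_walk_mulVec_one (ψ : Fin 2 × Grid n → ℂ) (x y : ZMod n) :
    ((walk n)ᴴ *ᵥ ψ) (1, (x, y)) =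
      (ψ (0, (x - 1, y + 1)) + ψ (1, (x - 1, y + 1))
        - ψ (0, (x + 1, y + 1)) + ψ (1, (x + 1, y + 1))) / 2 := by
  rw [walk, Matrix.conjTranspose_mul, ← Matrix.mulVec_mulVec, moveLeftRight_eq, moveUpDown_eq,
    conjTranspose_condMove, conjTranspose_condMove]
  simp only [condMove_mulVec, ketbra_ketUp, ketbra_ketDown, ketbra_ketLeft, ketbra_ketRight]
  simp
  ring

/-- `U + Uᴴ` acts as twice the diagonal random walk on the grid, for either coin state. -/
lemma walk_add_conjTranspose_mulVec (ψ : Fin 2 × Grid n → ℂ) (i : Fin 2) (x y : ZMod n) :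
    (walk n *ᵥ ψ) (i, (x, y)) + ((walk n)ᴴ *ᵥ ψ) (i, (x, y)) =
      (ψ (i, (x + 1, y + 1)) + ψ (i, (x + 1, y - 1))
        + ψ (i, (x - 1, y + 1)) + ψ (i, (x - 1, y - 1))) / 2 := by
  fin_cases i
  · simp only [Fin.zero_eta]
    rw [walk_mulVec_zero, conjTranspose_walk_mulVec_zero]
    ring
  · simp only [Fin.mk_one]
    rw [walk_mulVec_one, conjTranspose_walk_mulVec_one]
    ring

lemma walk_mulVec_uniformState : walk n *ᵥ uniformState n = uniformState n := by
  ext ⟨i, x, y⟩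
  fin_cases i
  · simp only [Fin.zero_eta]
    rw [walk_mulVec_zero]
    simp only [uniformState]
    ring
  · simp only [Fin.mk_one]
    rw [walk_mulVec_one]
    simp only [uniformState]
    ring

lemma star_walk_mulVec {ψ : Fin 2 × Grid n → ℂ} (h : star ψ = ψ) :
    star (walk n *ᵥ ψ) = walk n *ᵥ ψ := by
  have h' : ∀ p, (starRingEnd ℂ) (ψ p) = ψ p := fun p => congrFun h p
  ext ⟨i, x, y⟩
  fin_cases i
  · simp only [Fin.zero_eta, Pi.star_apply]
    rw [walk_mulVec_zero]
    simp [h']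
  · simp only [Fin.mk_one, Pi.star_apply]
    rw [walk_mulVec_one]
    simp [h']

lemma card_grid (n : ℕ) [NeZero n] : Fintype.card (Fin 2 × Grid n) = 2 * n ^ 2 := by
  simp [Fintype.card_prod, ZMod.card, pow_two]

lemma sqNorm_uniformState : sqNorm (uniformState n) = 1 := by
  have hc : (0 : ℝ) < Fintype.card (Fin 2 × Grid n) := by exact_mod_cast Fintype.card_pos
  simp only [sqNorm, uniformState, Finset.sum_const, Finset.card_univ, norm_inv,
    Complex.norm_real, Real.norm_of_nonneg (Real.sqrt_nonneg _), inv_pow,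
    Real.sq_sqrt hc.le, nsmul_eq_mul]
  exact mul_inv_cancel₀ hc.ne'

lemma ketS_apply (i : Fin 2) : ketS i = ((√2 : ℝ) : ℂ)⁻¹ := by
  fin_cases i <;> simp [ketS, ketUp, ketDown]

lemma star_ketSV_dotProduct (v : Grid n) (ψ : Fin 2 × Grid n → ℂ) :
    star (ketSV n v) ⬝ᵥ ψ = ((√2 : ℝ) : ℂ)⁻¹ * (ψ (0, v) + ψ (1, v)) := by
  rw [dotProduct, Fintype.sum_prod_type, Fin.sum_univ_two, mul_add]
  congr 1
  all_goals
    rw [Finset.sum_eq_single v]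
    · simp [ketSV, ketS_apply]
    · intro b _ hb
      simp [ketSV, hb]
    · simp

lemma sqNorm_ketSV (v : Grid n) : sqNorm (ketSV n v) = 1 := by
  have h := star_ketSV_dotProduct v (ketSV n v)
  rw [star_dotProduct_self] at h
  have h2 := inv_sqrt_two_mul_self
  simp only [ketSV, ketS_apply, if_true] at h
  have h3 : (sqNorm (ketSV n v) : ℂ) = 1 := by linear_combination h + 2 * h2
  exact_mod_cast h3

lemma norm_star_ketSV_dotProduct_uniformState (v : Grid n) :
    ‖star (ketSV n v) ⬝ᵥ uniformState n‖ = 1 / n := by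
  have hn : (0 : ℝ) < n := by exact_mod_cast Nat.pos_of_ne_zero (NeZero.ne n)
  rw [star_ketSV_dotProduct]
  simp only [uniformState]
  rw [card_grid, ← two_mul, ← Complex.ofReal_inv, ← Complex.ofReal_inv]
  have : (2 : ℂ) = ((2 : ℝ) : ℂ) := by norm_num
  rw [this, ← Complex.ofReal_mul, ← Complex.ofReal_mul, Complex.norm_real,
    Real.norm_of_nonneg (by positivity)]
  push_cast
  rw [Real.sqrt_mul (by norm_num), Real.sqrt_sq hn.le]
  have h2 : √2 * √2 = 2 := Real.mul_self_sqrt (by norm_num)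
  have : √2 ≠ 0 := by positivity
  field_simp
  nlinarith

/-- Cauchy–Schwarz on the coin block at v. It turns an amplitude bound into a bound on the measured
probability. -/
lemma norm_star_ketSV_dotProduct_sq_le (v : Grid n) (ψ : Fin 2 × Grid n → ℂ) :
    ‖star (ketSV n v) ⬝ᵥ ψ‖ ^ 2 ≤ probAt ψ v := by
  have h := norm_dotProduct_sq_le (ketSV n v) (fun p => if p.2 = v then ψ p else 0)
  rw [sqNorm_ketSV, one_mul, star_ketSV_dotProduct] at h
  rw [star_ketSV_dotProduct]
  simp only [if_true] at h
  refine h.trans (le_of_eq ?_)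
  rw [sqNorm, probAt, Fintype.sum_prod_type]
  refine Finset.sum_congr rfl fun i _ => ?_
  rw [Finset.sum_eq_single v]
  · simp
  · intro b _ hb
    simp [hb]
  · simp

end Walk

/-! ### The Green function of the diagonal random walk on the grid -/

section Green

variable {n : ℕ} [NeZero n]

/-- The cosine `cos (2πk/n)`, as the real part of the standard additive character. -/
noncomputable def cosAt (k : ZMod n) : ℝ := (ZMod.stdAddChar k : ℂ).re

lemma stdAddChar_neg (k : ZMod n) :
    (ZMod.stdAddChar (-k) : ℂ) = (starRingEnd ℂ) (ZMod.stdAddChar k) :=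
  AddChar.map_neg_eq_conj _ _

lemma cosAt_neg (k : ZMod n) : cosAt (-k) = cosAt k := by
  rw [cosAt, stdAddChar_neg, Complex.conj_re, cosAt]

lemma stdAddChar_add_neg (k : ZMod n) :
    (ZMod.stdAddChar k : ℂ) + ZMod.stdAddChar (-k) = 2 * cosAt k := by
  rw [stdAddChar_neg, Complex.add_conj, cosAt]
  push_cast
  ring

lemma norm_stdAddChar (k : ZMod n) : ‖(ZMod.stdAddChar k : ℂ)‖ = 1 :=
  AddChar.norm_apply _ _

lemma one_sub_cosAt_sq (k : ZMod n) : 1 - cosAt k ^ 2 = (1 - cosAt (k + k)) / 2 := by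
  have h1 : Complex.normSq (ZMod.stdAddChar k : ℂ) = 1 := by
    rw [Complex.normSq_eq_norm_sq, norm_stdAddChar, one_pow]
  rw [Complex.normSq_apply] at h1
  have h2 : cosAt (k + k) = cosAt k ^ 2 - (ZMod.stdAddChar k : ℂ).im ^ 2 := by
    rw [cosAt, AddChar.map_add_eq_mul, Complex.mul_re, cosAt]
    ring
  rw [h2, cosAt]
  linarith

lemma cosAt_intCast (j : ℤ) : cosAt (j : ZMod n) = Real.cos (2 * (Real.pi * j / n)) := by
  rw [cosAt, ZMod.stdAddChar_coe, show 2 * (Real.pi : ℂ) * Complex.I * j / n =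
    ((2 * (Real.pi * j / n) : ℝ) : ℂ) * Complex.I by push_cast; ring, Complex.exp_ofReal_mul_I_re]

/-- The distance of `2k` from `0` on the cycle of length `n`. -/
def doubleDist (k : ZMod n) : ℕ := (k + k).valMinAbs.natAbs

lemma doubleDist_lt (k : ZMod n) : doubleDist k < n :=
  lt_of_le_of_lt (ZMod.natAbs_valMinAbs_le _)
    (Nat.div_lt_self (Nat.pos_of_ne_zero (NeZero.ne n)) one_lt_two)

/-- The left-hand distance is that of 2k because sin² vanishes at both 0 and n/2. With j the
representative of 2k of least absolute value, the right side is sin²(πj/n), and Jordan's inequality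
applies since |j| ≤ n/2. -/
lemma le_one_sub_cosAt_sq (k : ZMod n) :
    4 * (doubleDist k : ℝ) ^ 2 / n ^ 2 ≤ 1 - cosAt k ^ 2 := by
  have hn : (0 : ℝ) < n := by exact_mod_cast Nat.pos_of_ne_zero (NeZero.ne n)
  set j := (k + k).valMinAbs with hj
  have hjn : (|j| : ℝ) ≤ n / 2 := by
    have h : j.natAbs ≤ n / 2 := ZMod.natAbs_valMinAbs_le _
    have h' : 2 * j.natAbs ≤ n := by omega
    have h'' : (2 : ℝ) * (j.natAbs : ℝ) ≤ n := by exact_mod_cast h'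
    rw [Nat.cast_natAbs, Int.cast_abs] at h''
    linarith
  have hd : (doubleDist k : ℝ) = |(j : ℝ)| := by
    rw [doubleDist, ← hj, Nat.cast_natAbs, Int.cast_abs]
  have hs : 2 * |(j : ℝ)| / n ≤ |Real.sin (Real.pi * j / n)| := by
    have h := Real.mul_le_sin (x := Real.pi * |(j : ℝ)| / n) (by positivity) (by
      rw [div_le_iff₀ hn]
      nlinarith [Real.pi_pos])
    calc 2 * |(j : ℝ)| / n = 2 / Real.pi * (Real.pi * |(j : ℝ)| / n) := by
          field_simp [Real.pi_pos.ne']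
      _ ≤ Real.sin (Real.pi * |(j : ℝ)| / n) := h
      _ ≤ |Real.sin (Real.pi * j / n)| := by
          rcases abs_cases (j : ℝ) with h | h
          · rw [h.1]; exact le_abs_self _
          · rw [h.1, mul_neg, neg_div, Real.sin_neg]; exact neg_le_abs _
  have hk : ((j : ℤ) : ZMod n) = k + k := ZMod.coe_valMinAbs _
  rw [one_sub_cosAt_sq, ← hk, cosAt_intCast, Real.cos_two_mul, hd]
  have h2 := pow_le_pow_left₀ (by positivity) hs 2
  rw [sq_abs] at h2
  have h3 := Real.sin_sq_add_cos_sq (Real.pi * j / n)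
  calc 4 * |(j : ℝ)| ^ 2 / n ^ 2 = (2 * |(j : ℝ)| / n) ^ 2 := by ring
    _ ≤ _ := h2
    _ = _ := by linarith

/-- The symbol of `(1 - z U) (1 - z Uᴴ)`. -/
noncomputable def symbol (z : ℝ) (k l : ZMod n) : ℝ := 1 + z ^ 2 - 2 * z * (cosAt k * cosAt l)

/-- The symbol equals (1-z)² + 2z(1 - cos·cos), with 2z ≥ 1, and 1 - ab ≥ ((1-a²) + (1-b²))/2.
Passing to squares also covers the frequencies where both cosines are near -1. -/
lemma le_symbol {z : ℝ} (hz : 1 / 2 ≤ z) (k l : ZMod n) :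
    (1 - z) ^ 2 + 2 / (n : ℝ) ^ 2 * ((doubleDist k : ℝ) ^ 2 + (doubleDist l : ℝ) ^ 2) ≤
      symbol z k l := by
  have hk := le_one_sub_cosAt_sq k
  have hl := le_one_sub_cosAt_sq l
  have h1 : 2 / (n : ℝ) ^ 2 * ((doubleDist k : ℝ) ^ 2 + (doubleDist l : ℝ) ^ 2) ≤
      1 - cosAt k * cosAt l := by
    have : 2 / (n : ℝ) ^ 2 * ((doubleDist k : ℝ) ^ 2 + (doubleDist l : ℝ) ^ 2) =
      (4 * (doubleDist k : ℝ) ^ 2 / n ^ 2 + 4 * (doubleDist l : ℝ) ^ 2 / n ^ 2) / 2 := by ring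
    nlinarith [sq_nonneg (cosAt k - cosAt l)]
  have h0 : 0 ≤ 1 - cosAt k * cosAt l := le_trans (by positivity) h1
  rw [symbol]
  nlinarith

lemma symbol_pos {z : ℝ} (hz : 1 / 2 ≤ z) (hz1 : z < 1) (k l : ZMod n) : 0 < symbol z k l :=
  lt_of_lt_of_le (add_pos_of_pos_of_nonneg (pow_pos (sub_pos.2 hz1) 2) (by positivity))
    (le_symbol hz k l)

/-- The Green function of the diagonal random walk. -/
noncomputable def green (n : ℕ) [NeZero n] (z : ℝ) (w : Grid n) : ℂ :=
  ∑ k : ZMod n, ∑ l : ZMod n,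
    (ZMod.stdAddChar (k * w.1) : ℂ) * ZMod.stdAddChar (l * w.2) / (n ^ 2 * symbol z k l)

lemma sum_stdAddChar_mul (x : ZMod n) :
    ∑ k : ZMod n, (ZMod.stdAddChar (k * x) : ℂ) = if x = 0 then (n : ℂ) else 0 := by
  rw [AddChar.sum_mulShift x (ZMod.isPrimitive_stdAddChar n), ZMod.card]
  split_ifs <;> simp

/-- Characters diagonalise the diagonal walk with eigenvalues cos·cos, so the operator multiplies
each mode by its symbol. The denominators cancel and orthogonality of characters leaves a delta. -/
lemma green_equation {z : ℝ} (hz : 1 / 2 ≤ z) (hz1 : z < 1) (x y : ZMod n) :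
    (1 + (z : ℂ) ^ 2) * green n z (x, y) -
      z * ((green n z (x + 1, y + 1) + green n z (x + 1, y - 1) + green n z (x - 1, y + 1)
        + green n z (x - 1, y - 1)) / 2) = if (x, y) = (0, 0) then 1 else 0 := by
  have hn : (n : ℂ) ≠ 0 := by exact_mod_cast NeZero.ne n
  have h : ∀ k l : ZMod n,
      (1 + (z : ℂ) ^ 2) * ((ZMod.stdAddChar (k * x) : ℂ) * ZMod.stdAddChar (l * y) /
        (n ^ 2 * symbol z k l)) -
      z * (((ZMod.stdAddChar (k * (x + 1)) : ℂ) * ZMod.stdAddChar (l * (y + 1)) /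
          (n ^ 2 * symbol z k l) +
        (ZMod.stdAddChar (k * (x + 1)) : ℂ) * ZMod.stdAddChar (l * (y - 1)) /
          (n ^ 2 * symbol z k l) +
        (ZMod.stdAddChar (k * (x - 1)) : ℂ) * ZMod.stdAddChar (l * (y + 1)) /
          (n ^ 2 * symbol z k l) +
        (ZMod.stdAddChar (k * (x - 1)) : ℂ) * ZMod.stdAddChar (l * (y - 1)) /
          (n ^ 2 * symbol z k l)) / 2) =
      (n ^ 2 : ℂ)⁻¹ * ((ZMod.stdAddChar (k * x) : ℂ) * ZMod.stdAddChar (l * y)) := by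
    intro k l
    have hs : (symbol z k l : ℂ) ≠ 0 := by exact_mod_cast (symbol_pos hz hz1 k l).ne'
    have hk := stdAddChar_add_neg k
    have hl := stdAddChar_add_neg l
    have hs' : (symbol z k l : ℂ) = 1 + z ^ 2 - 2 * z * (cosAt k * cosAt l) := by
      rw [symbol]; push_cast; ring
    simp only [sub_eq_add_neg x, sub_eq_add_neg y, mul_add, mul_one, mul_neg,
      AddChar.map_add_eq_mul]
    generalize (ZMod.stdAddChar (k * x) : ℂ) = X at *
    generalize (ZMod.stdAddChar (l * y) : ℂ) = Y at *
    generalize (ZMod.stdAddChar (-k) : ℂ) = K' at *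
    generalize (ZMod.stdAddChar (-l) : ℂ) = L' at *
    generalize (ZMod.stdAddChar k : ℂ) = K at *
    generalize (ZMod.stdAddChar l : ℂ) = L at *
    field_simp
    rw [hs']
    linear_combination (-(X * Y * z) * (L + L')) * hk - X * Y * z * 2 * cosAt k * hl
  have hsum : (1 + (z : ℂ) ^ 2) * green n z (x, y) -
      z * ((green n z (x + 1, y + 1) + green n z (x + 1, y - 1) + green n z (x - 1, y + 1)
        + green n z (x - 1, y - 1)) / 2) =
      ∑ k : ZMod n, ∑ l : ZMod n,
        (n ^ 2 : ℂ)⁻¹ * ((ZMod.stdAddChar (k * x) : ℂ) * ZMod.stdAddChar (l * y)) := by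
    simp only [← h, green, Finset.sum_sub_distrib, ← Finset.mul_sum, ← Finset.sum_div,
      Finset.sum_add_distrib]
  rw [hsum]
  simp only [← Finset.mul_sum, ← Finset.sum_mul, sum_stdAddChar_mul, Prod.mk.injEq]
  by_cases hx : x = 0 <;> by_cases hy : y = 0 <;> simp [hx, hy]
  field_simp

/-- Conjugation negates both frequencies, and the symbol is even. -/
lemma star_green (z : ℝ) (w : Grid n) : (starRingEnd ℂ) (green n z w) = green n z w := by
  simp only [green, map_sum, map_div₀, map_mul, map_pow, Complex.conj_ofReal, map_natCast,
    ← stdAddChar_neg, ← neg_mul]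
  rw [← Equiv.sum_comp (Equiv.neg (ZMod n))]
  refine Finset.sum_congr rfl fun k _ => ?_
  rw [← Equiv.sum_comp (Equiv.neg (ZMod n))]
  refine Finset.sum_congr rfl fun l _ => ?_
  simp [symbol, cosAt_neg]

lemma green_zero (z : ℝ) : green n z (0, 0) =
    ((∑ k : ZMod n, ∑ l : ZMod n, (symbol z k l)⁻¹) / (n : ℝ) ^ 2 : ℝ) := by
  simp only [green, mul_zero, AddChar.map_zero_eq_one, mul_one]
  push_cast
  simp only [Finset.sum_div]
  refine Finset.sum_congr rfl fun k _ => Finset.sum_congr rfl fun l _ => ?_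
  rw [one_div, mul_inv, div_eq_mul_inv, mul_comm]

/-! ### Logarithmic bound for the Green function at the origin -/

lemma card_doubleDist_fiber_le (i : ℕ) :
    (Finset.univ.filter fun k : ZMod n => doubleDist k = i).card ≤ 4 := by
  have hsub : (Finset.univ.filter fun k : ZMod n => doubleDist k = i) ⊆
      ({((i / 2 : ℕ) : ZMod n), (((i + n) / 2 : ℕ) : ZMod n), (((n - i) / 2 : ℕ) : ZMod n),
        (((2 * n - i) / 2 : ℕ) : ZMod n)} : Finset (ZMod n)) := by
    intro k hk
    have hk : doubleDist k = i := by simpa using hk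
    have hi : i < n := hk ▸ doubleDist_lt k
    have hkn := ZMod.val_lt k
    have hkk : ((k.val : ℕ) : ZMod n) = k := ZMod.natCast_zmod_val k
    have hj : (((k + k).valMinAbs : ℤ) : ZMod n) = ((2 * k.val : ℤ) : ZMod n) := by
      rw [ZMod.coe_valMinAbs]; push_cast; rw [hkk]; ring
    rw [ZMod.intCast_eq_intCast_iff_dvd_sub] at hj
    obtain ⟨q, hq⟩ := hj
    rw [doubleDist] at hk
    set j := (k + k).valMinAbs
    have hv : k.val = i / 2 ∨ k.val = (i + n) / 2 ∨ k.val = (n - i) / 2 ∨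
        k.val = (2 * n - i) / 2 := by
      -- Here nq = 2·`k.val` - j with |j| = i < n and 0 ≤ `k.val` < n, so q is 0, 1 or 2. These and
      -- the sign of j give the four candidates.
      have hq0 : -1 < q := by
        by_contra hc
        have h : (n : ℤ) * q ≤ (n : ℤ) * (-1) :=
          mul_le_mul_of_nonneg_left (by omega) (Int.natCast_nonneg n)
        omega
      have hq3 : q < 3 := by
        by_contra hc
        have h : (n : ℤ) * 3 ≤ (n : ℤ) * q :=
          mul_le_mul_of_nonneg_left (by omega) (Int.natCast_nonneg n)
        omega
      have : q = 0 ∨ q = 1 ∨ q = 2 := by omega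
      rcases this with rfl | rfl | rfl <;> omega
    rw [← hkk]
    rcases hv with h | h | h | h <;> rw [h] <;> simp
  exact (Finset.card_le_card hsub).trans Finset.card_le_four

lemma sum_doubleDist_le {F : ℕ → ℝ} (hF : ∀ i, 0 ≤ F i) :
    ∑ k : ZMod n, F (doubleDist k) ≤ 4 * ∑ i ∈ Finset.range n, F i := by
  rw [← Finset.sum_fiberwise_of_maps_to (t := Finset.range n) (g := doubleDist)
    fun k _ => Finset.mem_range.2 (doubleDist_lt k), Finset.mul_sum]
  refine Finset.sum_le_sum fun i _ => ?_
  rw [Finset.sum_congr rfl (g := fun _ => F i) fun k hk => by rw [(Finset.mem_filter.1 hk).2],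
    Finset.sum_const, nsmul_eq_mul]
  have := card_doubleDist_fiber_le (n := n) i
  gcongr
  · exact hF i
  · exact_mod_cast this

/-- Summing the inverse of a quadratic form over a square of lattice points costs a
logarithm. -/
lemma sum_inv_quadratic_le {a c : ℝ} (ha : 0 < a) (hc : 0 < c) (m : ℕ) :
    ∑ i ∈ Finset.range (m + 1), ∑ j ∈ Finset.range (m + 1),
      (a + c * ((i : ℝ) ^ 2 + (j : ℝ) ^ 2))⁻¹ ≤ a⁻¹ + 3 / c * (harmonic m : ℝ) := by
  induction m with
  | zero => simp
  | succ m ih =>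
    have hm : (0 : ℝ) < m + 1 := by positivity
    -- Enlarging the square adds an L-shaped shell of 2(m+1)+1 ≤ 3(m+1) points, each contributing at
    -- most 1/(c(m+1)²). Each shell thus costs at most 3/(c(m+1)), a harmonic term.
    have hb : ∀ i j : ℕ, i = m + 1 ∨ j = m + 1 →
        (a + c * ((i : ℝ) ^ 2 + (j : ℝ) ^ 2))⁻¹ ≤ (c * (m + 1 : ℝ) ^ 2)⁻¹ := by
      intro i j h
      apply inv_anti₀ (by positivity)
      have h1 : (m + 1 : ℝ) ^ 2 ≤ (i : ℝ) ^ 2 + (j : ℝ) ^ 2 := by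
        rcases h with h | h <;> rw [h] <;> push_cast <;>
          nlinarith [sq_nonneg (i : ℝ), sq_nonneg (j : ℝ)]
      nlinarith
    rw [Finset.sum_range_succ]
    simp_rw [Finset.sum_range_succ _ (m + 1)]
    rw [Finset.sum_add_distrib]
    have h1 : ∑ i ∈ Finset.range (m + 1),
        (a + c * ((i : ℝ) ^ 2 + ((m + 1 : ℕ) : ℝ) ^ 2))⁻¹ ≤ (m + 1) * (c * (m + 1 : ℝ) ^ 2)⁻¹ := by
      refine (Finset.sum_le_sum fun i _ => hb i (m + 1) (Or.inr rfl)).trans (le_of_eq ?_)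
      simp
    have h2 : ∑ j ∈ Finset.range (m + 1),
        (a + c * (((m + 1 : ℕ) : ℝ) ^ 2 + (j : ℝ) ^ 2))⁻¹ ≤ (m + 1) * (c * (m + 1 : ℝ) ^ 2)⁻¹ := by
      refine (Finset.sum_le_sum fun j _ => hb (m + 1) j (Or.inl rfl)).trans (le_of_eq ?_)
      simp
    have h3 := hb (m + 1) (m + 1) (Or.inl rfl)
    have h4 : (2 * (m + 1 : ℝ) + 1) * (c * (m + 1 : ℝ) ^ 2)⁻¹ ≤ 3 / c * (m + 1 : ℝ)⁻¹ := by
      rw [← div_eq_mul_inv, ← div_eq_mul_inv, div_div, div_le_div_iff₀ (by positivity)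
        (by positivity)]
      have : (0 : ℝ) ≤ m := by positivity
      nlinarith [mul_nonneg (mul_nonneg hc.le hm.le) this]
    rw [harmonic_succ]
    push_cast at h1 h2 h3 ih ⊢
    linarith

/-- The choice of 1 - z balances the mass term (1-z)⁻² = n²L against the lattice sum, which is at
most (3/2)n² · (3/2)L. With multiplicity 4 in each frequency the total is 16(1 + 9/4)L = 52L. -/
lemma green_zero_le {z L : ℝ} (hz : 1 / 2 ≤ z) (hz1 : z < 1) (hL : L = Real.log ((n : ℝ) ^ 2))
    (hL1 : 1 ≤ L) (hδ : ((1 - z) ^ 2)⁻¹ = n ^ 2 * L) :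
    (∑ k : ZMod n, ∑ l : ZMod n, (symbol z k l)⁻¹) / (n : ℝ) ^ 2 ≤ 64 * L := by
  have hn : (0 : ℝ) < n := by exact_mod_cast Nat.pos_of_ne_zero (NeZero.ne n)
  have hδ0 : 0 < (1 - z) ^ 2 := pow_pos (sub_pos.2 hz1) 2
  set F : ℕ → ℕ → ℝ := fun i j =>
    ((1 - z) ^ 2 + 2 / (n : ℝ) ^ 2 * ((i : ℝ) ^ 2 + (j : ℝ) ^ 2))⁻¹ with hF
  have hF0 : ∀ i j, 0 ≤ F i j := fun i j => by positivity
  obtain ⟨m, rfl⟩ : ∃ m, n = m + 1 := ⟨n - 1, by have := NeZero.ne n; omega⟩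
  have hlog : (harmonic m : ℝ) ≤ 3 / 2 * L := by
    rcases Nat.eq_zero_or_pos m with rfl | hm
    · simp; linarith
    have h1 := harmonic_le_one_add_log m
    have h2 : Real.log m ≤ Real.log ((m + 1 : ℕ) : ℝ) :=
      Real.log_le_log (by exact_mod_cast hm) (by push_cast; linarith)
    rw [Real.log_pow] at hL
    push_cast at hL h2
    linarith
  have hS := sum_inv_quadratic_le hδ0 (c := 2 / ((m + 1 : ℕ) : ℝ) ^ 2) (by positivity) m
  have key : ∑ k : ZMod (m + 1), ∑ l : ZMod (m + 1), (symbol z k l)⁻¹ ≤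
      4 * (4 * ∑ i ∈ Finset.range (m + 1), ∑ j ∈ Finset.range (m + 1), F i j) := by
    calc ∑ k : ZMod (m + 1), ∑ l : ZMod (m + 1), (symbol z k l)⁻¹
        ≤ ∑ k : ZMod (m + 1), ∑ l : ZMod (m + 1), F (doubleDist k) (doubleDist l) := by
          refine Finset.sum_le_sum fun k _ => Finset.sum_le_sum fun l _ => ?_
          exact inv_anti₀ (by positivity) (le_symbol hz k l)
      _ ≤ ∑ k : ZMod (m + 1), 4 * ∑ j ∈ Finset.range (m + 1), F (doubleDist k) j :=
          Finset.sum_le_sum fun k _ => sum_doubleDist_le (hF0 _)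
      _ = 4 * ∑ k : ZMod (m + 1), ∑ j ∈ Finset.range (m + 1), F (doubleDist k) j := by
          rw [Finset.mul_sum]
      _ ≤ _ := by
          gcongr
          exact sum_doubleDist_le (F := fun i => ∑ j ∈ Finset.range (m + 1), F i j)
            fun i => Finset.sum_nonneg fun j _ => hF0 i j
  rw [div_le_iff₀ (by positivity)]
  refine key.trans ?_
  rw [hδ] at hS
  have h5 : 3 / (2 / ((m + 1 : ℕ) : ℝ) ^ 2) = 3 / 2 * ((m + 1 : ℕ) : ℝ) ^ 2 := by
    field_simp
  rw [h5] at hS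
  have h6 := mul_le_mul_of_nonneg_left hlog
    (by positivity : 0 ≤ 3 / 2 * ((m + 1 : ℕ) : ℝ) ^ 2)
  have h7 : 0 ≤ ((m + 1 : ℕ) : ℝ) ^ 2 * L := by positivity
  linarith

end Green

/-! ### The quantum walk search -/

section WalkSearch

variable {n : ℕ} [NeZero n]

/-- The Green function centred at `v`, with coin state `s`. -/
noncomputable def greenState (n : ℕ) [NeZero n] (z : ℝ) (v : Grid n) : Fin 2 × Grid n → ℂ :=
  fun p => green n z (p.2 - v) * ketS p.1

/-- The vector `(1 - z Uᴴ)⁻¹ |s, v⟩`. -/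
noncomputable def resolventState (n : ℕ) [NeZero n] (z : ℝ) (v : Grid n) :
    Fin 2 × Grid n → ℂ :=
  greenState n z v - (z : ℂ) • (walk n *ᵥ greenState n z v)

lemma conj_ketS (i : Fin 2) : (starRingEnd ℂ) (ketS i) = ketS i := by
  rw [ketS_apply, map_inv₀, Complex.conj_ofReal]

lemma star_ketSV {n : ℕ} (v : Grid n) : star (ketSV n v) = ketSV n v := by
  ext p
  by_cases h : p.2 = v <;> simp [ketSV, h, conj_ketS]

lemma star_greenState (z : ℝ) (v : Grid n) : star (greenState n z v) = greenState n z v := by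
  ext p
  simp [greenState, star_green, conj_ketS]

lemma star_resolventState (z : ℝ) (v : Grid n) :
    star (resolventState n z v) = resolventState n z v := by
  rw [resolventState, star_sub, star_smul, star_walk_mulVec (star_greenState z v),
    star_greenState, Complex.star_def, Complex.conj_ofReal]

lemma resolventState_dotProduct_im (z : ℝ) (v : Grid n) :
    (star (resolventState n z v) ⬝ᵥ ketSV n v).im = 0 := by
  rw [← Complex.conj_eq_iff_im, ← Complex.star_def, ← star_dotProduct_comm, star_ketSV,
    star_resolventState, dotProduct_comm]

/-- By unitarity (1 - zUᴴ)(1 - zU) = 1 + z² - z(U + Uᴴ). As U + Uᴴ does not mix coin states, the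
claim reduces to the scalar Green equation centred at v. -/
lemma resolventState_equation {z : ℝ} (hz : 1 / 2 ≤ z) (hz1 : z < 1) (v : Grid n) :
    resolventState n z v - (z : ℂ) • ((walk n)ᴴ *ᵥ resolventState n z v) = ketSV n v := by
  have h1 : (walk n)ᴴ *ᵥ (walk n *ᵥ greenState n z v) = greenState n z v := by
    rw [Matrix.mulVec_mulVec, ← Matrix.star_eq_conjTranspose,
      Matrix.mem_unitaryGroup_iff'.1 walk_mem_unitaryGroup, Matrix.one_mulVec]
  rw [resolventState, Matrix.mulVec_sub, Matrix.mulVec_smul, h1]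
  ext ⟨i, x, y⟩
  have h2 := walk_add_conjTranspose_mulVec (greenState n z v) i x y
  have h3 := green_equation hz hz1 (x - v.1) (y - v.2)
  have h4 : ((x - v.1, y - v.2) = ((0, 0) : Grid n)) ↔ (x, y) = v := by
    simp only [Prod.ext_iff, sub_eq_zero]
  simp only [h4] at h3
  simp only [Pi.sub_apply, Pi.smul_apply, smul_eq_mul, ketSV]
  simp only [greenState, Prod.sub_def, sub_add_eq_add_sub, sub_right_comm _ (1 : ZMod n)] at h2 h3 ⊢
  have h5 : (if (x, y) = v then ketS i else 0) =
      (if (x, y) = v then (1 : ℂ) else 0) * ketS i := by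
    split_ifs <;> simp
  rw [h5, ← h3]
  linear_combination -(z : ℂ) * h2

lemma sqNorm_resolventState {z : ℝ} (hz : 1 / 2 ≤ z) (hz1 : z < 1) (v : Grid n) :
    sqNorm (resolventState n z v) =
      (∑ k : ZMod n, ∑ l : ZMod n, (symbol z k l)⁻¹) / (n : ℝ) ^ 2 := by
  -- Write one factor as (1 - zU)G and take the adjoint: ⟨η|η⟩ = ⟨G|(1 - zUᴴ)η⟩ = ⟨G|φ⟩, which is
  -- the Green function at the origin.
  have h1 : star (resolventState n z v) ⬝ᵥ resolventState n z v =
      star (greenState n z v) ⬝ᵥ ketSV n v := by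
    have h2 := star_dotProduct_mulVec (walk n)ᴴ (greenState n z v) (resolventState n z v)
    rw [Matrix.conjTranspose_conjTranspose] at h2
    rw [← resolventState_equation hz hz1 v, dotProduct_sub, dotProduct_smul, h2]
    conv_lhs => rw [resolventState]
    rw [star_sub, star_smul, sub_dotProduct, smul_dotProduct, Complex.star_def,
      Complex.conj_ofReal]
    rfl
  rw [star_dotProduct_self, star_greenState, dotProduct_comm, ← star_ketSV,
    star_ketSV_dotProduct] at h1
  simp only [greenState, sub_self, ketS_apply] at h1
  rw [show (0 : Grid n) = (0, 0) from rfl, green_zero] at h1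
  have h3 := inv_sqrt_two_mul_self
  have h4 : (sqNorm (resolventState n z v) : ℂ) =
      ((∑ k : ZMod n, ∑ l : ZMod n, (symbol z k l)⁻¹) / (n : ℝ) ^ 2 : ℝ) := by
    rw [h1]
    linear_combination (2 * (((∑ k : ZMod n, ∑ l : ZMod n, (symbol z k l)⁻¹) /
      (n : ℝ) ^ 2 : ℝ) : ℂ)) * h3
  exact_mod_cast h4

lemma markedWalk_mulVec (v : Grid n) (ψ : Fin 2 × Grid n → ℂ) :
    markedWalk n v *ᵥ ψ =
      walk n *ᵥ (ψ - (2 * (star (ketSV n v) ⬝ᵥ ψ)) • ketSV n v) := by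
  rw [markedWalk, ← Matrix.mulVec_mulVec, Matrix.sub_mulVec, Matrix.one_mulVec,
    Matrix.smul_mulVec, ketbra_mulVec, smul_smul]

/-! ### Translation invariance of the marked walk -/

lemma walk_mulVec_translate (v : Grid n) (ψ : Fin 2 × Grid n → ℂ) :
    (fun p => (walk n *ᵥ ψ) (p.1, p.2 + v)) = walk n *ᵥ fun p => ψ (p.1, p.2 + v) := by
  obtain ⟨a, b⟩ := v
  ext ⟨i, x, y⟩
  fin_cases i
  · simp only [Fin.zero_eta, Prod.mk_add_mk, walk_mulVec_zero, add_right_comm _ (1 : ZMod n),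
      sub_add_eq_add_sub]
  · simp only [Fin.mk_one, Prod.mk_add_mk, walk_mulVec_one, add_right_comm _ (1 : ZMod n),
      sub_add_eq_add_sub]

lemma markedWalk_mulVec_translate (v : Grid n) (ψ : Fin 2 × Grid n → ℂ) :
    (fun p => (markedWalk n v *ᵥ ψ) (p.1, p.2 + v)) =
      markedWalk n 0 *ᵥ fun p => ψ (p.1, p.2 + v) := by
  rw [markedWalk_mulVec, markedWalk_mulVec, walk_mulVec_translate]
  congr 1
  ext p
  simp only [Pi.sub_apply, Pi.smul_apply, star_ketSV_dotProduct, ketSV, smul_eq_mul, zero_add]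
  simp

lemma markedWalk_pow_mulVec_translate (v : Grid n) (T : ℕ) :
    (fun p => ((markedWalk n v ^ T) *ᵥ uniformState n) (p.1, p.2 + v)) =
      (markedWalk n 0 ^ T) *ᵥ uniformState n := by
  induction T with
  | zero => simp only [pow_zero, Matrix.one_mulVec]; rfl
  | succ T ih =>
    rw [pow_succ', pow_succ', ← Matrix.mulVec_mulVec, ← Matrix.mulVec_mulVec,
      markedWalk_mulVec_translate, ih]

/-- The success probability does not depend on the marked vertex. -/
lemma walkSuccess_eq (v : Grid n) (T : ℕ) : walkSuccess n v T = walkSuccess n 0 T := by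
  rw [walkSuccess, walkSuccess, probAt, probAt, ← markedWalk_pow_mulVec_translate v T]
  simp

lemma one_le_log_sq {n : ℕ} (hn : 2 ≤ n) : 1 ≤ Real.log ((n : ℝ) ^ 2) := by
  have h2 : (2 : ℝ) ≤ n := by exact_mod_cast hn
  have h := Real.log_le_log (by norm_num) h2
  rw [Real.log_pow]
  push_cast
  linarith [Real.log_two_gt_d9]

/-- The quantum walk search finds the marked vertex with probability `Ω(1 / log N)` after
`O(√(N log N))` steps. -/
theorem exists_walkSuccess_ge (hn : 2 ≤ n) :
    ∃ T : ℕ, (T : ℝ) ≤ 4 * √((n : ℝ) ^ 2 * Real.log ((n : ℝ) ^ 2)) ∧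
      ∀ v : Grid n, (1 / 2048) ^ 2 / Real.log ((n : ℝ) ^ 2) ≤ walkSuccess n v T := by
  have hn2 : (2 : ℝ) ≤ n := by exact_mod_cast hn
  have hL1 := one_le_log_sq hn
  set L := Real.log ((n : ℝ) ^ 2) with hL
  have hL0 : 0 < L := by linarith
  set R := √((n : ℝ) ^ 2 * L) with hR
  have hR2 : R ^ 2 = (n : ℝ) ^ 2 * L := Real.sq_sqrt (by positivity)
  have hR_two : 2 ≤ R := Real.le_sqrt_of_sq_le (by nlinarith)
  have hRn : R = n * √L := by rw [hR, Real.sqrt_mul (by positivity), Real.sqrt_sq (by positivity)]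
  have hsL : 0 < √L := Real.sqrt_pos.2 hL0
  have hsL2 : √L * √L = L := Real.mul_self_sqrt hL0.le
  set z : ℝ := 1 - R⁻¹ with hz
  have hRi : R⁻¹ ≤ 1 / 2 := by rw [one_div]; exact inv_anti₀ (by norm_num) hR_two
  have hRi0 : 0 < R⁻¹ := by positivity
  have hz0 : 1 / 2 ≤ z := by linarith
  have hz1 : z < 1 := by linarith
  -- Three multiples of R = 1/(1-z) suffice: z^T₀ ≤ e⁻³ ≤ 1/16 beats the factor 8 in √(64L) = 8√L.
  -- Rounding up stays below 4R because R ≥ 2.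
  set T₀ : ℕ := ⌈3 * R⌉₊ with hT₀
  have hT1 : 3 * R ≤ T₀ := Nat.le_ceil _
  have hT2 : (T₀ : ℝ) ≤ 4 * R := by
    have := (Nat.ceil_lt_add_one (by positivity : 0 ≤ 3 * R)).le
    linarith
  have hB : sqNorm (resolventState n z 0) ≤ 64 * L := by
    rw [sqNorm_resolventState hz0 hz1]
    exact green_zero_le hz0 hz1 hL hL1 (by rw [hz, sub_sub_cancel, inv_pow, inv_inv, hR2])
  -- If every time up to 4R fails at some vertex, translation invariance makes every such time fail
  -- at vertex 0, so all amplitudes there are small.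
  by_contra! hcon
  have hε : ∀ t < T₀, ‖star (ketSV n 0) ⬝ᵥ
      (((walk n * (1 - (2 : ℂ) • ketbra (ketSV n 0))) ^ t) *ᵥ uniformState n)‖ ≤
        1 / 2048 / √L := by
    intro t ht
    have ht' : (t : ℝ) ≤ T₀ := by exact_mod_cast ht.le
    obtain ⟨v, hv⟩ := hcon t (ht'.trans hT2)
    rw [walkSuccess_eq] at hv
    have h1 := (norm_star_ketSV_dotProduct_sq_le 0 _).trans hv.le
    refine le_of_sq_le_sq (h1.trans (le_of_eq ?_)) (by positivity)
    rw [div_pow (1 / 2048), Real.sq_sqrt hL0.le]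
  have key := exists_large_amplitude walk_mem_unitaryGroup walk_mulVec_uniformState
    sqNorm_uniformState (sqNorm_ketSV 0) (by linarith) hz1
    (resolventState_equation hz0 hz1 0) (resolventState_dotProduct_im z 0) hB T₀ hε
  rw [norm_star_ketSV_dotProduct_uniformState, show 1 - z = R⁻¹ by rw [hz]; ring] at key
  have hfirst : 1 / (n : ℝ) / R⁻¹ = √L := by
    rw [hRn]
    field_simp
  have hzT : z ^ T₀ ≤ 1 / 16 := by
    have h1 : z ^ T₀ ≤ Real.exp (-3) := by
      calc z ^ T₀ ≤ Real.exp (-R⁻¹) ^ T₀ := by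
            gcongr
            have := Real.add_one_le_exp (-R⁻¹)
            linarith
        _ = Real.exp (T₀ * (-R⁻¹)) := by rw [← Real.exp_nat_mul]
        _ ≤ Real.exp (-3) := by
            apply Real.exp_le_exp.2
            have : 3 ≤ T₀ * R⁻¹ := by
              rw [← div_eq_mul_inv, le_div_iff₀ (by positivity)]
              exact hT1
            linarith
    have h2 : (16 : ℝ) ≤ Real.exp 3 := by
      have h3 := Real.exp_one_gt_d9
      calc (16 : ℝ) ≤ 2.7 ^ 3 := by norm_num
        _ ≤ Real.exp 1 ^ 3 := by gcongr; linarith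
        _ = Real.exp 3 := by rw [← Real.exp_nat_mul]; norm_num
    rw [Real.exp_neg] at h1
    refine h1.trans ?_
    rw [one_div]
    exact inv_anti₀ (by norm_num) h2
  have hsB : √(64 * L) = 8 * √L := by
    rw [Real.sqrt_mul (by norm_num), show (64 : ℝ) = 8 ^ 2 by norm_num,
      Real.sqrt_sq (by norm_num)]
  rw [hfirst, hsB] at key
  have hright : (1 - z ^ 2) * (64 * L) * (T₀ * (1 / 2048 / √L)) ≤ √L / 4 := by
    have h1 : 1 - z ^ 2 ≤ 2 * R⁻¹ := by rw [hz]; nlinarith [sq_nonneg R⁻¹]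
    calc (1 - z ^ 2) * (64 * L) * (T₀ * (1 / 2048 / √L))
        ≤ (2 * R⁻¹) * (64 * L) * ((4 * R) * (1 / 2048 / √L)) := by gcongr
      _ = √L / 4 := by
          have : R ≠ 0 := by positivity
          field_simp
          rw [Real.sq_sqrt hL0.le]
          ring
  -- The left side of `key` is at least √L - √L/2, the right side at most √L/4.
  nlinarith

end WalkSearch

/-! ### Sequences of local steps -/

section Steps

/-- Adjacency is symmetric. This allows a local algorithm to be run backwards, as amplification
requires. -/
lemma IsZLocal.star {ι V : Type*} {G : SimpleGraph V}
    {U : Matrix (ι × V) (ι × V) ℂ} (hU : IsZLocal G U) :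
    IsZLocal G (star U) := by
  intro i j v w h
  have h' : U (i, v) (j, w) ≠ 0 := fun h0 => h (by
    rw [Matrix.star_eq_conjTranspose, Matrix.conjTranspose_apply, h0, star_zero])
  rcases hU j i w v h' with rfl | h1
  · exact Or.inl rfl
  · exact Or.inr h1.symm

variable {ι V : Type} [Fintype ι] [DecidableEq ι] [Fintype V] [DecidableEq V]
  {G : SimpleGraph V}

lemma Step.op_query (a : V → Bool) (U₀ U₁ : Matrix.unitaryGroup ι ℂ) :
    (Step.query U₀ U₁ : Step ι G).op a =
      Matrix.blockDiagonal fun v => if a v then U₁.1 else U₀.1 := by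
  ext p q
  rw [Matrix.blockDiagonal_apply]
  by_cases h : p.2 = q.2
  · cases ha : a q.2 <;> simp [Step.op, h, ha]
  · simp [Step.op, h]

/-- The inverse of a step. -/
def Step.inv : Step ι G → Step ι G
  | .query U₀ U₁ => .query (star U₀) (star U₁)
  | .localStep U hU => .localStep (star U) hU.star

lemma Step.op_inv (a : V → Bool) (s : Step ι G) : s.inv.op a = (s.op a)ᴴ := by
  cases s with
  | query U₀ U₁ =>
    rw [Step.inv, Step.op_query, Step.op_query, Matrix.blockDiagonal_conjTranspose]
    congr 1
    ext v : 1
    split_ifs <;> rfl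
  | localStep U hU => rfl

lemma Step.op_mem_unitaryGroup (a : V → Bool) (s : Step ι G) :
    s.op a ∈ Matrix.unitaryGroup (ι × V) ℂ := by
  cases s with
  | query U₀ U₁ =>
    rw [Matrix.mem_unitaryGroup_iff, Matrix.star_eq_conjTranspose, Step.op_query,
      Matrix.blockDiagonal_conjTranspose, ← Matrix.blockDiagonal_mul,
      ← Matrix.blockDiagonal_one]
    congr 1
    ext v : 1
    split_ifs
    · exact Matrix.mem_unitaryGroup_iff.1 U₁.2
    · exact Matrix.mem_unitaryGroup_iff.1 U₀.2
  | localStep U hU => exact U.2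

/-- The inverse of a sequence of steps. -/
def invSteps (l : List (Step ι G)) : List (Step ι G) := (l.map Step.inv).reverse

@[simp] lemma length_invSteps (l : List (Step ι G)) : (invSteps l).length = l.length := by
  simp [invSteps]

lemma finalState_append (l l' : List (Step ι G)) (ψ : ι × V → ℂ) (a : V → Bool) :
    finalState (l ++ l') ψ a = finalState l' (finalState l ψ a) a := by
  simp [finalState, List.foldl_append]

lemma finalState_cons (s : Step ι G) (l : List (Step ι G)) (ψ : ι × V → ℂ) (a : V → Bool) :
    finalState (s :: l) ψ a = finalState l (s.op a *ᵥ ψ) a := rfl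

/-- The operator applied by a sequence of steps. -/
def totalOp (a : V → Bool) : List (Step ι G) → Matrix (ι × V) (ι × V) ℂ
  | [] => 1
  | s :: l => totalOp a l * s.op a

lemma finalState_eq (l : List (Step ι G)) (ψ : ι × V → ℂ) (a : V → Bool) :
    finalState l ψ a = totalOp a l *ᵥ ψ := by
  induction l generalizing ψ with
  | nil => simp [finalState, totalOp]
  | cons s l ih => rw [finalState_cons, ih, totalOp, Matrix.mulVec_mulVec]

lemma totalOp_mem_unitaryGroup (a : V → Bool) (l : List (Step ι G)) :
    totalOp a l ∈ Matrix.unitaryGroup (ι × V) ℂ := by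
  induction l with
  | nil => exact one_mem _
  | cons s l ih => exact mul_mem ih (s.op_mem_unitaryGroup a)

lemma finalState_invSteps (l : List (Step ι G)) (ψ : ι × V → ℂ) (a : V → Bool) :
    finalState (invSteps l) ψ a = (totalOp a l)ᴴ *ᵥ ψ := by
  induction l generalizing ψ with
  | nil => simp [finalState, totalOp, invSteps]
  | cons s l ih =>
    have : invSteps (s :: l) = invSteps l ++ [s.inv] := by simp [invSteps]
    rw [this, finalState_append, ih, totalOp, Matrix.conjTranspose_mul, ← Matrix.mulVec_mulVec,
      finalState_cons, Step.op_inv]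
    rfl

end Steps

/-! ### Amplitude amplification -/

section Amplification

/-- The restriction of a vector to the indices in the set `S`. -/
def restrict {m : Type*} (S : m → Bool) (ψ : m → ℂ) : m → ℂ := fun i => if S i then ψ i else 0

/-- The vector with the signs of the entries in `S` flipped. -/
def flipSigns {m : Type*} (S : m → Bool) (ψ : m → ℂ) : m → ℂ := fun i => if S i then -ψ i else ψ i

lemma star_dotProduct_restrict {m : Type*} [Fintype m] (S : m → Bool)
    (χ : m → ℂ) :
    star χ ⬝ᵥ restrict S χ = (sqNorm (restrict S χ) : ℂ) := by
  rw [← star_dotProduct_self]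
  refine Finset.sum_congr rfl fun i _ => ?_
  cases h : S i <;> simp [restrict, h]

section Round

variable {m : Type*} [Fintype m] [DecidableEq m]

/-- One round of amplitude amplification acts as a rotation on the span of the two parts of
the state `χ`. -/
lemma amplification_round (S : m → Bool) {χ : m → ℂ} (hχ : sqNorm χ = 1) {p : ℝ}
    (hp : sqNorm (restrict S χ) = p) (x y : ℝ) :
    ((2 : ℂ) • ketbra χ - 1) *ᵥ
        flipSigns S ((x : ℂ) • restrict S χ + (y : ℂ) • (χ - restrict S χ)) =
      (((1 - 2 * p) * x + 2 * (1 - p) * y : ℝ) : ℂ) • restrict S χ +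
        (((1 - 2 * p) * y - 2 * p * x : ℝ) : ℂ) • (χ - restrict S χ) := by
  have h1 : flipSigns S ((x : ℂ) • restrict S χ + (y : ℂ) • (χ - restrict S χ)) =
      (-x : ℂ) • restrict S χ + (y : ℂ) • (χ - restrict S χ) := by
    ext i
    cases h : S i <;> simp [flipSigns, restrict, h]
  have h2 : star χ ⬝ᵥ ((-x : ℂ) • restrict S χ + (y : ℂ) • (χ - restrict S χ)) =
      -x * p + y * (1 - p) := by
    rw [dotProduct_add, dotProduct_smul, dotProduct_smul, dotProduct_sub,
      star_dotProduct_restrict, star_dotProduct_self, hχ, hp]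
    simp
  rw [h1, Matrix.sub_mulVec, Matrix.one_mulVec, Matrix.smul_mulVec, ketbra_mulVec, h2]
  ext i
  simp only [Pi.add_apply, Pi.sub_apply, Pi.smul_apply, smul_eq_mul]
  push_cast
  ring

end Round

/-- Some odd multiple of an angle has a large sine. -/
lemma exists_sin_odd_mul_ge {p : ℝ} (hp0 : 0 < p) (hp1 : p ≤ 1) :
    ∃ m : ℕ, (m : ℝ) ≤ 1 / √p ∧
      1 / 2 ≤ Real.sin ((2 * m + 1) * Real.arcsin √p) ^ 2 := by
  have hs0 : 0 < √p := Real.sqrt_pos.2 hp0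
  have hs1 : √p ≤ 1 := Real.sqrt_le_one.2 hp1
  set θ := Real.arcsin √p with hθ
  have hsin : Real.sin θ = √p := Real.sin_arcsin (by linarith) hs1
  have hsin2 : Real.sin θ ^ 2 = p := by rw [hsin, Real.sq_sqrt hp0.le]
  have hθ0 : 0 < θ := Real.arcsin_pos.2 hs0
  by_cases hp : 1 / 2 ≤ p
  · exact ⟨0, by simp, by simpa [hsin2] using hp⟩
  · push Not at hp
    have hθs : √p ≤ θ := hsin ▸ Real.sin_le hθ0.le
    have hθ2 : θ ≤ Real.pi / 2 := Real.arcsin_le_pi_div_two _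
    -- This choice puts (2m+1)θ within θ of π/2, so its sine is at least cos θ, and cos²θ = 1 - p >
    -- 1/2 in this case.
    refine ⟨⌊Real.pi / (4 * θ)⌋₊, ?_, ?_⟩
    · calc ((⌊Real.pi / (4 * θ)⌋₊ : ℕ) : ℝ) ≤ Real.pi / (4 * θ) :=
            Nat.floor_le (by positivity)
        _ ≤ 1 / θ := by
            rw [div_le_div_iff₀ (by positivity) hθ0]
            nlinarith [Real.pi_le_four]
        _ ≤ 1 / √p := one_div_le_one_div_of_le hs0 hθs
    · set m := ⌊Real.pi / (4 * θ)⌋₊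
      have h1 : (m : ℝ) * (4 * θ) ≤ Real.pi := by
        rw [← le_div_iff₀ (by positivity)]
        exact Nat.floor_le (by positivity)
      have h2 : Real.pi < (m + 1) * (4 * θ) := by
        rw [← div_lt_iff₀ (by positivity)]
        exact Nat.lt_floor_add_one _
      have h3 : |Real.pi / 2 - (2 * m + 1) * θ| ≤ θ := by
        rw [abs_le]; constructor <;> linarith
      have h4 : Real.cos θ ≤ Real.sin ((2 * m + 1) * θ) := by
        rw [← Real.cos_pi_div_two_sub, ← Real.cos_abs (Real.pi / 2 - _)]
        exact Real.cos_le_cos_of_nonneg_of_le_pi (abs_nonneg _) (by linarith [Real.pi_pos]) h3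
      have h5 : 0 ≤ Real.cos θ :=
        Real.cos_nonneg_of_mem_Icc ⟨by linarith [Real.pi_pos], hθ2⟩
      have h6 := pow_le_pow_left₀ h5 h4 2
      have h7 := Real.sin_sq_add_cos_sq θ
      linarith

variable {ι V : Type} [Fintype ι] [DecidableEq ι] [Fintype V] [DecidableEq V]
  {G : SimpleGraph V}

lemma algorithmSuccess_eq (l : List (Step ι G)) (ψ : ι × V → ℂ) (a : V → Bool) :
    algorithmSuccess l ψ a = sqNorm (restrict (fun p => a p.2) (finalState l ψ a)) := by
  rw [algorithmSuccess, sqNorm, Fintype.sum_prod_type_right]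
  refine Finset.sum_congr rfl fun v _ => ?_
  cases h : a v <;> simp [restrict, probAt, h]

/-- The query that flips the sign at the marked vertices. -/
def flipQuery : Step ι G := .query 1 (-1)

lemma flipQuery_op_mulVec (a : V → Bool) (ψ : ι × V → ℂ) :
    (flipQuery : Step ι G).op a *ᵥ ψ = flipSigns (fun p => a p.2) ψ := by
  have h : (flipQuery : Step ι G).op a =
      Matrix.diagonal fun p => if a p.2 then (-1 : ℂ) else 1 := by
    have hneg : ((-1 : Matrix.unitaryGroup ι ℂ) : Matrix ι ι ℂ) = -1 := rfl
    ext p q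
    rw [flipQuery, Step.op_query, Matrix.blockDiagonal_apply, Matrix.diagonal_apply]
    by_cases hpq : p = q
    · subst hpq
      cases ha : a p.2 <;> simp [hneg]
    · by_cases h2 : p.2 = q.2
      · have h1 : p.1 ≠ q.1 := fun h1 => hpq (Prod.ext h1 h2)
        cases ha : a p.2 <;> simp [← h2, hneg, hpq, h1]
      · simp [h2, hpq]
  rw [h]
  ext p
  rw [Matrix.mulVec_diagonal]
  cases ha : a p.2 <;> simp [flipSigns, ha]

/-- The local step that reflects about a state `o` located at a single vertex. -/
noncomputable def reflectStep (o : ι × V → ℂ) (ho : sqNorm o = 1) (v₀ : V)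
    (hv : ∀ p, o p ≠ 0 → p.2 = v₀) : Step ι G :=
  .localStep ⟨(2 : ℂ) • ketbra o - 1, by
    have h := reflection_mem_unitaryGroup o 2 (by rw [ho]; norm_num)
    have h2 : (2 : ℂ) • ketbra o - 1 = -(1 - ((2 : ℝ) : ℂ) • ketbra o) := by
      rw [neg_sub]; norm_num
    rw [h2, Matrix.mem_unitaryGroup_iff, star_neg, neg_mul_neg]
    exact Matrix.mem_unitaryGroup_iff.1 h⟩ (by
    intro i j v w h
    left
    by_contra hne
    apply h
    have h1 : (1 : Matrix (ι × V) (ι × V) ℂ) (j, w) (i, v) = 0 :=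
      Matrix.one_apply_ne fun h => hne (Prod.ext_iff.1 h).2
    have h2 : o (j, w) = 0 ∨ o (i, v) = 0 := by
      by_contra! hc
      exact hne ((hv _ hc.1).trans (hv _ hc.2).symm)
    change ((2 : ℂ) • ketbra o - 1 : Matrix (ι × V) (ι × V) ℂ) (j, w) (i, v) = 0
    rw [Matrix.sub_apply, h1, Matrix.smul_apply, ketbra, Matrix.vecMulVec_apply, Pi.star_apply]
    rcases h2 with h2 | h2 <;> simp [h2])

/-- One round of amplitude amplification of the algorithm `l`. -/
def amplificationRound (l : List (Step ι G)) (r : Step ι G) : List (Step ι G) :=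
  flipQuery :: (invSteps l ++ r :: l)

/-- The algorithm `l` followed by `m` rounds of amplitude amplification. -/
def amplify (l : List (Step ι G)) (r : Step ι G) : ℕ → List (Step ι G)
  | 0 => l
  | m + 1 => amplify l r m ++ amplificationRound l r

lemma length_amplify (l : List (Step ι G)) (r : Step ι G) (m : ℕ) :
    (amplify l r m).length = l.length + m * (2 * l.length + 2) := by
  induction m with
  | zero => simp [amplify]
  | succ m ih =>
    simp only [amplify, amplificationRound, List.length_append, List.length_cons,
      length_invSteps, ih]
    ring

lemma finalState_amplificationRound (l : List (Step ι G)) {o : ι × V → ℂ} (ho : sqNorm o = 1)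
    {v₀ : V} (hv : ∀ p, o p ≠ 0 → p.2 = v₀) (ψ : ι × V → ℂ) (a : V → Bool) :
    finalState (amplificationRound l (reflectStep o ho v₀ hv)) ψ a =
      ((2 : ℂ) • ketbra (finalState l o a) - 1) *ᵥ flipSigns (fun p => a p.2) ψ := by
  rw [amplificationRound, finalState_cons, flipQuery_op_mulVec, finalState_append,
    finalState_invSteps, finalState_cons, finalState_eq, finalState_eq]
  generalize flipSigns (fun p => a p.2) ψ = φ
  have hA := totalOp_mem_unitaryGroup a l
  set A := totalOp a l
  change A *ᵥ (((2 : ℂ) • ketbra o - 1) *ᵥ (Aᴴ *ᵥ φ)) = _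
  rw [Matrix.sub_mulVec, Matrix.sub_mulVec, Matrix.one_mulVec, Matrix.one_mulVec,
    Matrix.smul_mulVec, Matrix.smul_mulVec, ketbra_mulVec, ketbra_mulVec, Matrix.mulVec_sub,
    Matrix.mulVec_smul, Matrix.mulVec_smul, Matrix.mulVec_mulVec,
    ← Matrix.star_eq_conjTranspose, Matrix.mem_unitaryGroup_iff.1 hA, Matrix.one_mulVec,
    Matrix.star_eq_conjTranspose, star_dotProduct_mulVec, Matrix.conjTranspose_conjTranspose]

lemma finalState_amplify (l : List (Step ι G)) {o : ι × V → ℂ} (ho : sqNorm o = 1)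
    {v₀ : V} (hv : ∀ p, o p ≠ 0 → p.2 = v₀) {a : V → Bool} {θ : ℝ}
    (hθ : algorithmSuccess l o a = Real.sin θ ^ 2) (m : ℕ) :
    ∃ x y : ℝ, x * Real.sin θ = Real.sin ((2 * m + 1) * θ) ∧
      y * Real.cos θ = Real.cos ((2 * m + 1) * θ) ∧
      finalState (amplify l (reflectStep o ho v₀ hv) m) o a =
        (x : ℂ) • restrict (fun p => a p.2) (finalState l o a) +
          (y : ℂ) • (finalState l o a - restrict (fun p => a p.2) (finalState l o a)) := by
  induction m with
  | zero => exact ⟨1, 1, by simp, by simp, by simp [amplify]⟩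
  | succ m ih =>
    obtain ⟨x, y, hx, hy, h⟩ := ih
    have hχ : sqNorm (finalState l o a) = 1 := by
      rw [finalState_eq, sqNorm_mulVec (totalOp_mem_unitaryGroup a l), ho]
    rw [algorithmSuccess_eq] at hθ
    have h1 : (2 * ((m + 1 : ℕ) : ℝ) + 1) * θ = (2 * m + 1) * θ + 2 * θ := by push_cast; ring
    have hcs := Real.sin_sq_add_cos_sq θ
    refine ⟨_, _, ?_, ?_, by
      rw [amplify, finalState_append, h, finalState_amplificationRound,
        amplification_round _ hχ hθ]⟩
    · rw [h1, Real.sin_add, Real.cos_two_mul, Real.sin_two_mul, ← hx, ← hy]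
      linear_combination (-2 * Real.sin θ * (x + y)) * hcs
    · rw [h1, Real.cos_add, Real.cos_two_mul, Real.sin_two_mul, ← hx, ← hy]
      linear_combination (-2 * y * Real.cos θ) * hcs

/-- Amplitude amplification: an algorithm with success probability `p` can be amplified to
constant success probability in `O(1 / √p)` rounds. -/
theorem exists_amplify {p : ℝ} (hp0 : 0 < p) (hp1 : p ≤ 1) (l : List (Step ι G))
    {o : ι × V → ℂ} (ho : sqNorm o = 1) {v₀ : V} (hv : ∀ q, o q ≠ 0 → q.2 = v₀) :
    ∃ m : ℕ, (m : ℝ) ≤ 1 / √p ∧ ∀ a : V → Bool, algorithmSuccess l o a = p →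
      1 / 2 ≤ algorithmSuccess (amplify l (reflectStep o ho v₀ hv) m) o a := by
  obtain ⟨m, hm, hs⟩ := exists_sin_odd_mul_ge hp0 hp1
  refine ⟨m, hm, fun a ha => ?_⟩
  have hθ : Real.sin (Real.arcsin √p) ^ 2 = p := by
    rw [Real.sin_arcsin (by linarith [Real.sqrt_nonneg p]) (Real.sqrt_le_one.2 hp1),
      Real.sq_sqrt hp0.le]
  obtain ⟨x, y, hx, -, h⟩ := finalState_amplify l ho hv (ha.trans hθ.symm) m
  rw [algorithmSuccess_eq, h]
  have h1 : restrict (fun q : ι × V => a q.2)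
      ((x : ℂ) • restrict (fun q => a q.2) (finalState l o a) +
        (y : ℂ) • (finalState l o a - restrict (fun q => a q.2) (finalState l o a))) =
      (x : ℂ) • restrict (fun q => a q.2) (finalState l o a) := by
    ext q
    cases hq : a q.2 <;> simp [restrict, hq]
  have h2 : sqNorm ((x : ℂ) • restrict (fun q => a q.2) (finalState l o a)) = x ^ 2 * p := by
    rw [← ha, algorithmSuccess_eq, sqNorm, sqNorm, Finset.mul_sum]
    refine Finset.sum_congr rfl fun q _ => ?_
    rw [Pi.smul_apply, norm_smul, mul_pow, Complex.norm_real, Real.norm_eq_abs, sq_abs]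
  rw [h1, h2, ← hθ, ← mul_pow, hx]
  exact hs

end Amplification

/-! ### Preparing the uniform superposition locally -/

section Householder

variable {m : Type*} [Fintype m] [DecidableEq m]

/-- The Householder reflection that exchanges two real vectors of the same norm. -/
noncomputable def householder (a b : m → ℂ) : Matrix m m ℂ :=
  1 - ((2 / sqNorm (a - b) : ℝ) : ℂ) • ketbra (a - b)

lemma householder_mem_unitaryGroup (a b : m → ℂ) :
    householder a b ∈ Matrix.unitaryGroup m ℂ := by
  apply reflection_mem_unitaryGroup
  by_cases h : sqNorm (a - b) = 0
  · simp [h]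
  · field_simp

lemma householder_mulVec {a b : m → ℂ} (ha : star a = a) (hb : star b = b)
    (hab : sqNorm a = sqNorm b) : householder a b *ᵥ a = b := by
  have h1 : (sqNorm (a - b) : ℂ) = 2 * (star (a - b) ⬝ᵥ a) := by
    have h2 : star a ⬝ᵥ b = star b ⬝ᵥ a := by rw [ha, hb, dotProduct_comm]
    rw [← star_dotProduct_self, star_sub, sub_dotProduct, sub_dotProduct, dotProduct_sub,
      dotProduct_sub, star_dotProduct_self, star_dotProduct_self, ← hab, h2]
    ring
  rw [householder, Matrix.sub_mulVec, Matrix.one_mulVec, Matrix.smul_mulVec, ketbra_mulVec,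
    smul_smul]
  by_cases h : sqNorm (a - b) = 0
  · have h0 : a - b = 0 := by
      ext i
      have h3 := (Finset.sum_eq_zero_iff_of_nonneg fun i _ => by positivity).1 h i
        (Finset.mem_univ i)
      simpa using h3
    rw [h0, smul_zero, sub_zero]
    exact sub_eq_zero.1 h0
  · have h' : (sqNorm (a - b) : ℂ) ≠ 0 := by exact_mod_cast h
    have h4 : ((2 / sqNorm (a - b) : ℝ) : ℂ) * (star (a - b) ⬝ᵥ a) = 1 := by
      push_cast
      rw [div_mul_eq_mul_div, ← h1, div_self h']
    rw [h4, one_smul, sub_sub_cancel]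

lemma householder_apply_ne_zero {a b : m → ℂ} {i j : m} (h : householder a b i j ≠ 0) :
    i = j ∨ (a i ≠ b i ∧ a j ≠ b j) := by
  by_contra! hc
  apply h
  rw [householder, Matrix.sub_apply, Matrix.one_apply_ne hc.1, Matrix.smul_apply, ketbra,
    Matrix.vecMulVec_apply, Pi.star_apply, Pi.sub_apply, Pi.sub_apply]
  by_cases hi : a i = b i
  · simp [hi]
  · simp [hc.2 hi]

end Householder

section Preparation

variable {n : ℕ} [NeZero n]

lemma sum_zmod_val (F : ℕ → ℝ) : ∑ x : ZMod n, F x.val = ∑ i ∈ Finset.range n, F i :=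
  Finset.sum_bij (fun x _ => x.val) (fun x _ => Finset.mem_range.2 (ZMod.val_lt x))
    (fun _ _ _ _ h => ZMod.val_injective n h)
    (fun i hi => ⟨(i : ZMod n), Finset.mem_univ _, ZMod.val_cast_of_lt (Finset.mem_range.1 hi)⟩)
    fun _ _ => rfl

/-- The state on the cycle that is uniform on the first `k` vertices, with the remaining
amplitude at the vertex `k`. -/
noncomputable def ramp (n k : ℕ) : ZMod n → ℂ := fun x =>
  ((if x.val < k then (√n)⁻¹ else if x.val = k then √(1 - k / n) else 0 : ℝ) : ℂ)

lemma star_ramp {n : ℕ} (k : ℕ) : star (ramp n k) = ramp n k := by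
  ext x
  simp only [ramp, Pi.star_apply, Complex.star_def, Complex.conj_ofReal]

lemma sqNorm_ramp {k : ℕ} (hk : k < n) : sqNorm (ramp n k) = 1 := by
  have hn : (0 : ℝ) < n := by exact_mod_cast Nat.pos_of_ne_zero (NeZero.ne n)
  have hkn : (k : ℝ) / n ≤ 1 := by
    rw [div_le_one hn]; exact_mod_cast hk.le
  obtain ⟨F, hF⟩ : ∃ F : ℕ → ℝ, ∀ i, F i =
      (if i < k then (n : ℝ)⁻¹ else 0) + if i = k then 1 - (k : ℝ) / n else 0 := ⟨_, fun _ => rfl⟩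
  have h : ∀ x : ZMod n, ‖ramp n k x‖ ^ 2 = F x.val := by
    intro x
    rw [hF, ramp, Complex.norm_real, Real.norm_eq_abs, sq_abs]
    by_cases h1 : x.val < k
    · simp [h1, h1.ne, Real.sq_sqrt hn.le]
    · by_cases h2 : x.val = k
      · simp [h2, Real.sq_sqrt (sub_nonneg.2 hkn)]
      · simp [h1, h2]
  rw [sqNorm, Finset.sum_congr rfl fun x _ => h x, sum_zmod_val, Finset.sum_congr rfl fun i _ => hF i,
    Finset.sum_add_distrib,
    Finset.sum_ite_eq' _ k, if_pos (Finset.mem_range.2 hk), ← Finset.sum_filter]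
  have h3 : (Finset.range n).filter (· < k) = Finset.range k := by
    ext i
    simp only [Finset.mem_filter, Finset.mem_range]
    omega
  rw [h3, Finset.sum_const, Finset.card_range, nsmul_eq_mul, div_eq_mul_inv]
  ring

lemma ramp_zero_apply {n : ℕ} (x : ZMod n) : ramp n 0 x = if x = 0 then 1 else 0 := by
  by_cases h : x = 0 <;> simp [ramp, ZMod.val_eq_zero, h]

lemma ramp_last_apply (x : ZMod n) : ramp n (n - 1) x = (((√n)⁻¹ : ℝ) : ℂ) := by
  have hn : 0 < n := Nat.pos_of_ne_zero (NeZero.ne n)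
  have hn' : (n : ℝ) ≠ 0 := by exact_mod_cast hn.ne'
  have hx := ZMod.val_lt x
  rw [ramp]
  congr 1
  split_ifs with h1 h2
  · rfl
  · rw [Nat.cast_sub hn, ← Real.sqrt_inv]
    congr 1
    push_cast
    field_simp
    ring
  · omega

lemma val_eq_of_ramp_ne {n k : ℕ} {x : ZMod n} (h : ramp n k x ≠ ramp n (k + 1) x) :
    x.val = k ∨ x.val = k + 1 := by
  by_contra! hc
  apply h
  have : x.val < k + 1 ↔ x.val < k := by omega
  simp [ramp, hc.1, hc.2, this]

lemma sub_mem_of_val {k : ℕ} {x x' : ZMod n} (hx : x.val = k ∨ x.val = k + 1)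
    (hx' : x'.val = k ∨ x'.val = k + 1) : x = x' ∨ x - x' = 1 ∨ x' - x = 1 := by
  have e := ZMod.natCast_zmod_val x
  have e' := ZMod.natCast_zmod_val x'
  rcases hx with hx | hx <;> rcases hx' with hx' | hx' <;> rw [hx] at e <;> rw [hx'] at e' <;>
    rw [← e, ← e'] <;> simp

/-- The reflection that extends the uniform part of the ramp by one vertex. -/
noncomputable def rampUnitary (n : ℕ) [NeZero n] (k : ℕ) : Matrix (ZMod n) (ZMod n) ℂ :=
  householder (ramp n k) (ramp n (k + 1))

lemma rampUnitary_mulVec {k : ℕ} (hk : k + 1 < n) :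
    rampUnitary n k *ᵥ ramp n k = ramp n (k + 1) :=
  householder_mulVec (star_ramp k) (star_ramp _)
    ((sqNorm_ramp (by omega)).trans (sqNorm_ramp hk).symm)

lemma rampUnitary_apply_ne_zero {k : ℕ} {x x' : ZMod n} (h : rampUnitary n k x x' ≠ 0) :
    x = x' ∨ x - x' = 1 ∨ x' - x = 1 := by
  rcases householder_apply_ne_zero h with h | ⟨h1, h2⟩
  · exact Or.inl h
  · exact sub_mem_of_val (val_eq_of_ramp_ne h1) (val_eq_of_ramp_ne h2)

lemma eq_or_adj_of_fst {n : ℕ} {v w : Grid n} (h2 : w.2 = v.2)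
    (h1 : w.1 = v.1 ∨ w.1 - v.1 = 1 ∨ v.1 - w.1 = 1) : w = v ∨ (gridGraph n).Adj v w := by
  by_cases h : w = v
  · exact Or.inl h
  right
  rw [gridGraph, SimpleGraph.circulantGraph_adj]
  refine ⟨fun h' => h h'.symm, ?_⟩
  rcases h1 with h1 | h1 | h1
  · exact absurd (Prod.ext h1 h2) h
  · right; left; ext <;> simp [h1, h2]
  · left; left; ext <;> simp [h1, h2]

lemma eq_or_adj_of_snd {n : ℕ} {v w : Grid n} (h1 : w.1 = v.1)
    (h2 : w.2 = v.2 ∨ w.2 - v.2 = 1 ∨ v.2 - w.2 = 1) : w = v ∨ (gridGraph n).Adj v w := by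
  by_cases h : w = v
  · exact Or.inl h
  right
  rw [gridGraph, SimpleGraph.circulantGraph_adj]
  refine ⟨fun h' => h h'.symm, ?_⟩
  rcases h2 with h2 | h2 | h2
  · exact absurd (Prod.ext h1 h2) h
  · right; right; ext <;> simp [h1, h2]
  · left; right; ext <;> simp [h1, h2]

/-- The local step that extends the ramp in the horizontal direction. -/
noncomputable def rampStepX (n : ℕ) [NeZero n] (k : ℕ) : Step (Fin 2) (gridGraph n) :=
  .localStep ⟨(1 : Matrix (Fin 2) (Fin 2) ℂ) ⊗ₖ (rampUnitary n k ⊗ₖ (1 : Matrix _ _ ℂ)),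
    Matrix.kronecker_mem_unitary (one_mem _)
      (Matrix.kronecker_mem_unitary (householder_mem_unitaryGroup _ _) (one_mem _))⟩ (by
    intro i j v w h
    have h' : (1 : Matrix (Fin 2) (Fin 2) ℂ) j i *
      (rampUnitary n k w.1 v.1 * (1 : Matrix (ZMod n) (ZMod n) ℂ) w.2 v.2) ≠ 0 := h
    have h1 := left_ne_zero_of_mul (right_ne_zero_of_mul h')
    have h2 := right_ne_zero_of_mul (right_ne_zero_of_mul h')
    exact eq_or_adj_of_fst (by_contra fun hne => h2 (Matrix.one_apply_ne hne))
      (rampUnitary_apply_ne_zero h1))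

/-- The local step that extends the ramp in the vertical direction. -/
noncomputable def rampStepY (n : ℕ) [NeZero n] (k : ℕ) : Step (Fin 2) (gridGraph n) :=
  .localStep ⟨(1 : Matrix (Fin 2) (Fin 2) ℂ) ⊗ₖ ((1 : Matrix _ _ ℂ) ⊗ₖ rampUnitary n k),
    Matrix.kronecker_mem_unitary (one_mem _)
      (Matrix.kronecker_mem_unitary (one_mem _) (householder_mem_unitaryGroup _ _))⟩ (by
    intro i j v w h
    have h' : (1 : Matrix (Fin 2) (Fin 2) ℂ) j i *
      ((1 : Matrix (ZMod n) (ZMod n) ℂ) w.1 v.1 * rampUnitary n k w.2 v.2) ≠ 0 := h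
    have h1 := left_ne_zero_of_mul (right_ne_zero_of_mul h')
    have h2 := right_ne_zero_of_mul (right_ne_zero_of_mul h')
    exact eq_or_adj_of_snd (by_contra fun hne => h1 (Matrix.one_apply_ne hne))
      (rampUnitary_apply_ne_zero h2))

/-- The tensor product of two vectors. -/
def tensor {l m : Type*} (a : l → ℂ) (b : m → ℂ) : l × m → ℂ := fun p => a p.1 * b p.2

lemma kronecker_mulVec_tensor {l m : Type*} [Fintype l] [Fintype m] (A : Matrix l l ℂ)
    (B : Matrix m m ℂ) (a : l → ℂ) (b : m → ℂ) :
    (A ⊗ₖ B) *ᵥ tensor a b = tensor (A *ᵥ a) (B *ᵥ b) := by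
  ext ⟨i, j⟩
  simp only [Matrix.mulVec, dotProduct, tensor, Matrix.kroneckerMap_apply,
    Fintype.sum_prod_type, Finset.sum_mul_sum]
  exact Finset.sum_congr rfl fun x _ => Finset.sum_congr rfl fun y _ => by ring

/-- The query, independent of the input, that rotates the coin from `⇑` to `s`. -/
noncomputable def coinStep (n : ℕ) [NeZero n] : Step (Fin 2) (gridGraph n) :=
  .query ⟨householder ketUp ketS, householder_mem_unitaryGroup _ _⟩
    ⟨householder ketUp ketS, householder_mem_unitaryGroup _ _⟩

lemma sqNorm_ketS : sqNorm ketS = 1 := by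
  simp only [sqNorm, ketS_apply, Fin.sum_univ_two, norm_inv, Complex.norm_real, inv_pow,
    Real.norm_eq_abs, sq_abs]
  rw [Real.sq_sqrt (by norm_num)]
  norm_num

lemma coinStep_op_mulVec (a : Grid n → Bool) (g : Grid n → ℂ) :
    (coinStep n).op a *ᵥ tensor ketUp g = tensor ketS g := by
  have h1 : star ketUp = ketUp := by
    ext i; fin_cases i <;> simp [ketUp]
  have h2 : star ketS = ketS := by
    ext i; exact conj_ketS i
  have h3 : sqNorm ketUp = sqNorm ketS := by
    rw [sqNorm_ketS]; simp [sqNorm, ketUp]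
  rw [coinStep, Step.op_query]
  simp only [ite_self]
  rw [← Matrix.kronecker_one, kronecker_mulVec_tensor, householder_mulVec h1 h2 h3,
    Matrix.one_mulVec]

/-- The steps that turn the located state into the uniform superposition. -/
noncomputable def prepSteps (n : ℕ) [NeZero n] : List (Step (Fin 2) (gridGraph n)) :=
  coinStep n :: ((List.range (n - 1)).map (rampStepX n) ++ (List.range (n - 1)).map (rampStepY n))

lemma length_prepSteps : (prepSteps n).length = 2 * (n - 1) + 1 := by
  simp [prepSteps]
  omega

lemma finalState_rampStepX (c : Fin 2 → ℂ) (g : ZMod n → ℂ) (a : Grid n → Bool) {k : ℕ}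
    (hk : k < n) :
    finalState ((List.range k).map (rampStepX n)) (tensor c (tensor (ramp n 0) g)) a =
      tensor c (tensor (ramp n k) g) := by
  induction k with
  | zero => rfl
  | succ k ih =>
    rw [List.range_succ, List.map_append, finalState_append, ih (by omega)]
    change ((1 : Matrix (Fin 2) (Fin 2) ℂ) ⊗ₖ (rampUnitary n k ⊗ₖ (1 : Matrix _ _ ℂ))) *ᵥ _ = _
    rw [kronecker_mulVec_tensor, kronecker_mulVec_tensor, Matrix.one_mulVec, Matrix.one_mulVec,
      rampUnitary_mulVec hk]

lemma finalState_rampStepY (c : Fin 2 → ℂ) (f : ZMod n → ℂ) (a : Grid n → Bool) {k : ℕ}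
    (hk : k < n) :
    finalState ((List.range k).map (rampStepY n)) (tensor c (tensor f (ramp n 0))) a =
      tensor c (tensor f (ramp n k)) := by
  induction k with
  | zero => rfl
  | succ k ih =>
    rw [List.range_succ, List.map_append, finalState_append, ih (by omega)]
    change ((1 : Matrix (Fin 2) (Fin 2) ℂ) ⊗ₖ ((1 : Matrix _ _ ℂ) ⊗ₖ rampUnitary n k)) *ᵥ _ = _
    rw [kronecker_mulVec_tensor, kronecker_mulVec_tensor, Matrix.one_mulVec, Matrix.one_mulVec,
      rampUnitary_mulVec hk]

lemma originState_eq {n : ℕ} : originState n = tensor ketUp (tensor (ramp n 0) (ramp n 0)) := by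
  ext ⟨i, x, y⟩
  simp only [originState, tensor, ramp_zero_apply, Prod.mk.injEq]
  by_cases hx : x = 0 <;> by_cases hy : y = 0 <;> simp [hx, hy]

lemma finalState_prepSteps (a : Grid n → Bool) :
    finalState (prepSteps n) (originState n) a = uniformState n := by
  have hn : n - 1 < n := Nat.sub_lt (Nat.pos_of_ne_zero (NeZero.ne n)) one_pos
  rw [prepSteps, finalState_cons, originState_eq, coinStep_op_mulVec, finalState_append,
    finalState_rampStepX _ _ _ hn, finalState_rampStepY _ _ _ hn]
  ext ⟨i, x, y⟩
  simp only [tensor, ramp_last_apply, ketS_apply, uniformState]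
  rw [card_grid, ← Complex.ofReal_inv, ← Complex.ofReal_inv, ← Complex.ofReal_mul,
    ← Complex.ofReal_mul]
  congr 1
  push_cast
  have h0 : (0 : ℝ) ≤ n := Nat.cast_nonneg n
  rw [Real.sqrt_mul (by norm_num), Real.sqrt_sq h0, ← mul_inv, ← mul_inv, Real.mul_self_sqrt h0]

end Preparation

/-! ### The walk as a sequence of local steps -/

section LocalWalk

variable {n : ℕ} [NeZero n]

lemma condMove_apply_ne_zero {n : ℕ} {a b : Fin 2 → ℂ} {g h : Grid n} {i j : Fin 2}
    {v w : Grid n} (H : condMove n a b g h (j, w) (i, v) ≠ 0) : w = v + g ∨ w = v + h := by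
  by_contra! hc
  apply H
  simp [condMove, shift, hc.1, hc.2]

lemma isZLocal_moveUpDown {n : ℕ} : IsZLocal (gridGraph n) (moveUpDown n) := by
  intro i j v w h
  rw [moveUpDown_eq] at h
  rcases condMove_apply_ne_zero h with rfl | rfl
  · exact eq_or_adj_of_snd (by simp) (by simp)
  · exact eq_or_adj_of_snd (by simp) (by simp)

lemma isZLocal_moveLeftRight {n : ℕ} : IsZLocal (gridGraph n) (moveLeftRight n) := by
  intro i j v w h
  rw [moveLeftRight_eq] at h
  rcases condMove_apply_ne_zero h with rfl | rfl
  · exact eq_or_adj_of_fst (by simp) (by simp)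
  · exact eq_or_adj_of_fst (by simp) (by simp)

/-- The query that reflects the coin about `s` at the marked vertices. -/
noncomputable def coinReflection (n : ℕ) [NeZero n] : Step (Fin 2) (gridGraph n) :=
  .query 1 ⟨1 - (2 : ℂ) • ketbra ketS, by
    simpa using reflection_mem_unitaryGroup ketS 2 (by rw [sqNorm_ketS]; norm_num)⟩

lemma coinReflection_op (v : Grid n) :
    (coinReflection n).op (fun w => decide (w = v)) = 1 - (2 : ℂ) • ketbra (ketSV n v) := by
  ext ⟨i, w⟩ ⟨j, w'⟩
  rw [coinReflection, Step.op_query, Matrix.blockDiagonal_apply]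
  simp only [Matrix.sub_apply, Matrix.smul_apply, ketbra, Matrix.vecMulVec_apply, Pi.star_apply,
    ketSV, Matrix.one_apply, Prod.mk.injEq, smul_eq_mul]
  by_cases hw : w = w'
  · subst hw
    by_cases hv : w = v
    · subst hv
      simp [Matrix.one_apply, Matrix.vecMulVec_apply]
    · simp [hv, Matrix.one_apply]
  · by_cases hv : w = v
    · have : ¬ w' = v := fun h => hw (hv.trans h.symm)
      simp [hw, this]
    · simp [hw, hv]

/-- The steps of the search by quantum walk. -/
noncomputable def walkSteps (n : ℕ) [NeZero n] : ℕ → List (Step (Fin 2) (gridGraph n))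
  | 0 => prepSteps n
  | T + 1 => walkSteps n T ++ [coinReflection n,
      .localStep ⟨moveUpDown n, moveUpDown_mem_unitaryGroup⟩ isZLocal_moveUpDown,
      .localStep ⟨moveLeftRight n, moveLeftRight_mem_unitaryGroup⟩ isZLocal_moveLeftRight]

lemma length_walkSteps (T : ℕ) : (walkSteps n T).length = 2 * (n - 1) + 1 + 3 * T := by
  induction T with
  | zero => rw [walkSteps, length_prepSteps]
  | succ T ih => rw [walkSteps, List.length_append, ih]; simp; omega

lemma finalState_walkSteps (v : Grid n) (T : ℕ) :
    finalState (walkSteps n T) (originState n) (fun w => decide (w = v)) =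
      (markedWalk n v ^ T) *ᵥ uniformState n := by
  induction T with
  | zero => rw [walkSteps, finalState_prepSteps, pow_zero, Matrix.one_mulVec]
  | succ T ih =>
    rw [walkSteps, finalState_append, ih, finalState_cons, coinReflection_op, pow_succ',
      ← Matrix.mulVec_mulVec, markedWalk, ← Matrix.mulVec_mulVec, walk, ← Matrix.mulVec_mulVec]
    rfl

lemma algorithmSuccess_walkSteps (v : Grid n) (T : ℕ) :
    algorithmSuccess (walkSteps n T) (originState n) (fun w => decide (w = v)) =
      walkSuccess n v T := by
  rw [algorithmSuccess, finalState_walkSteps, walkSuccess]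
  simp

lemma sqNorm_originState : sqNorm (originState n) = 1 := by
  have h : star (originState n) ⬝ᵥ originState n = 1 := by
    rw [dotProduct, Fintype.sum_prod_type, Fin.sum_univ_two]
    simp [originState, ketUp]
  rw [star_dotProduct_self] at h
  exact_mod_cast h

lemma walkSuccess_le_one (v : Grid n) (T : ℕ) : walkSuccess n v T ≤ 1 := by
  rw [← algorithmSuccess_walkSteps, algorithmSuccess_eq]
  have h : sqNorm (finalState (walkSteps n T) (originState n) fun w => decide (w = v)) = 1 := by
    rw [finalState_eq, sqNorm_mulVec (totalOp_mem_unitaryGroup _ _), sqNorm_originState]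
  rw [← h]
  refine Finset.sum_le_sum fun p _ => ?_
  by_cases hp : p.2 = v <;> simp [restrict, hp]

/-- A local search algorithm that finds the marked vertex with constant probability in
`O(√N log N)` steps. -/
theorem exists_algorithmSuccess_ge (hn : 2 ≤ n) :
    ∃ steps : List (Step (Fin 2) (gridGraph n)),
      (steps.length : ℝ) ≤ 57358 * (n * Real.log ((n : ℝ) ^ 2)) ∧
      ∀ v : Grid n, 1 / 2 ≤
        algorithmSuccess steps (originState n) fun w => decide (w = v) := by
  obtain ⟨T, hT, hs⟩ := exists_walkSuccess_ge hn
  have hL1 := one_le_log_sq hn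
  set L := Real.log ((n : ℝ) ^ 2)
  have hL0 : 0 < L := by linarith
  have hp := hs 0
  have hp0 : 0 < walkSuccess n 0 T := lt_of_lt_of_le (by positivity) hp
  have hloc : ∀ q : Fin 2 × Grid n, originState n q ≠ 0 → q.2 = (0, 0) := fun q hq =>
    by_contra fun h => hq (by simp [originState, h])
  obtain ⟨m, hm, hA⟩ := exists_amplify hp0 (walkSuccess_le_one 0 T) (walkSteps n T)
    sqNorm_originState hloc
  refine ⟨_, ?_, fun v => hA _ ?_⟩
  · have hsL : 1 ≤ √L := Real.one_le_sqrt.2 hL1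
    have hsL2 : √L * √L = L := Real.mul_self_sqrt hL0.le
    have hn0 : (0 : ℝ) ≤ n := Nat.cast_nonneg n
    have hT' : (T : ℝ) ≤ 4 * (n * √L) := by
      rwa [Real.sqrt_mul (by positivity), Real.sqrt_sq hn0] at hT
    have hm' : (m : ℝ) ≤ 2048 * √L := by
      refine hm.trans ?_
      have h1 : 1 / 2048 / √L ≤ √(walkSuccess n 0 T) := by
        apply Real.le_sqrt_of_sq_le
        rwa [div_pow, Real.sq_sqrt hL0.le]
      calc 1 / √(walkSuccess n 0 T) ≤ 1 / (1 / 2048 / √L) :=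
            one_div_le_one_div_of_le (by positivity) h1
        _ = 2048 * √L := by field_simp
    have hlen : ((walkSteps n T).length : ℝ) + 1 ≤ 14 * (n * √L) := by
      have h1 : (walkSteps n T).length + 1 = 2 * n + 3 * T := by
        rw [length_walkSteps]; omega
      have h2 : ((walkSteps n T).length : ℝ) + 1 = 2 * n + 3 * T := by exact_mod_cast h1
      rw [h2]
      nlinarith
    rw [length_amplify]
    push_cast
    have h3 : (m : ℝ) * (2 * (walkSteps n T).length + 2) ≤ 2048 * √L * (28 * (n * √L)) :=
      mul_le_mul hm' (by linarith) (by positivity) (by positivity)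
    have h4 : 2048 * √L * (28 * (n * √L)) = 57344 * (n * L) := by
      linear_combination 57344 * (n : ℝ) * hsL2
    have h5 : n * √L ≤ n * L := by
      gcongr
      nlinarith
    linarith
  · rw [algorithmSuccess_walkSteps, walkSuccess_eq]

end LocalWalk

end GridSearch

theorem theorem3 :
    -- the quantum walk search: `O(√(N log N))` steps, success probability `Ω(1 / log N)`
    (∃ C c : ℝ, 0 < C ∧ 0 < c ∧
      ∀ (n : ℕ) [NeZero n], 2 ≤ n → ∀ N : ℝ, N = (n : ℝ) ^ 2 →
        ∃ T : ℕ, (T : ℝ) ≤ C * √(N * Real.log N) ∧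
          ∀ v : GridSearch.Grid n, c / Real.log N ≤ GridSearch.walkSuccess n v T) ∧
    -- a local search algorithm with `O(√N log N)` steps and constant success probability
    (∃ C c : ℝ, 0 < C ∧ 0 < c ∧
      ∀ (n : ℕ) [NeZero n], 2 ≤ n → ∀ N : ℝ, N = (n : ℝ) ^ 2 →
        ∃ steps : List (GridSearch.Step (Fin 2) (GridSearch.gridGraph n)),
          (steps.length : ℝ) ≤ C * (√N * Real.log N) ∧
          ∀ v : GridSearch.Grid n,
            c ≤ GridSearch.algorithmSuccess steps (GridSearch.originState n)
              (fun w => decide (w = v))) := by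
  refine ⟨⟨4, (1 / 2048) ^ 2, by norm_num, by norm_num, ?_⟩,
    57358, 1 / 2, by norm_num, by norm_num, ?_⟩
  · rintro n _ hn N rfl
    exact GridSearch.exists_walkSuccess_ge hn
  · rintro n _ hn N rfl
    rw [Real.sqrt_sq (Nat.cast_nonneg n)]
    exact GridSearch.exists_algorithmSuccess_ge hn
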